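/- **Theorem 2.10.** Let $K$ be a field and let $A$ be a smooth $K$-algebra of finite type such that $\operatorname{Spec}(A)$ is purely of dimension $n$. Let $f,f_1,\dots,f_r\in A$, put $I=(f_1,\dots,f_r)$ and $B=A/I$, and assume that $\operatorname{Spec}(B)$ is smooth over $K$ and purely of codimension $r$ in $\operatorname{Spec}(A)$. Let $\bar f$ be the image of $f$ in $B$ and let $B[y]=B[y_1,\dots,y_r]$ be the polynomial ring. Let $(\Omega^{\bullet}_{B/K},\phi_{\bar f})$ be the complex with differential $\phi_{\bar f}(\omega)=d\bar f\wedge\omega$, and let $\Omega^{\bullet}_{B/K}[-r]$ be the complex with $\Omega^{i-r}_{B/K}$ in degree $i$ and the same differential $\phi_{\bar f}$ (forms of negative degree are zero). Let $(\Omega^{\bullet}_{A/K}\otimes_A B[y],\tilde\phi_F)$ be the complex with differential $$\tilde\phi_F(\xi)=d_{A/K}F\wedge\xi,\qquad d_{A/K}F=df\otimes 1+\sum_{i=1}^r df_i\otimes y_i\in\Omega^1_{A/K}\otimes_A B[y],$$ where $(\omega_1\otimes\alpha_1)\wedge(\omega_2\otimes\alpha_2)=(\omega_1\wedge\omega_2)\otimes\alpha_1\alpha_2$.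 For $d\in\mathbb Z$ let $F_dB[y]$ be the $B$-module of polynomials of total degree at most $d$ (zero for $d<0$), put $F_d(\Omega^k_{A/K}\otimes_A B[y])=\Omega^k_{A/K}\otimes_A F_{d+k}B[y]$, and let $$L^k=\{\xi\in F_{-k}(\Omega^k_{A/K}\otimes_A B[y])\;:\;\tilde\phi_F(\xi)\in F_{-k-1}(\Omega^{k+1}_{A/K}\otimes_A B[y])\}.$$ Then there is a quasi-isomorphism of complexes of $A$-modules $$(\Omega^{\bullet}_{B/K}[-r],\phi_{\bar f})\hookrightarrow(\Omega^{\bullet}_{A/K}\otimes_A B[y],\tilde\phi_F)$$ that is injective in every degree and whose image in degree $k$ is $L^k$ for every $k$. In particular, there are isomorphisms of $A$-modules, for all $i\in\mathbb Z$, $$H^{i-r}(\Omega^{\bullet}_{B/K},\phi_{\bar f})\simeq H^i(\Omega^{\bullet}_{A/K}\otimes_A B[y],\tilde\phi_F).$$ -/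

import Mathlib

open scoped KaehlerDifferential TensorProduct

namespace LagrangeKoszul

universe u v

section Wedge

variable (R : Type u) [CommRing R] (M : Type u) [AddCommGroup M] [Module R M]

/-- The `i`-th exterior power of `M`, for every integer `i`, as a submodule of the exterior
algebra; it is zero for `i < 0`. -/
def extPow : ℤ → Submodule R (ExteriorAlgebra R M)
  | Int.ofNat k => ⋀[R]^k M
  | Int.negSucc _ => ⊥

variable {R M}

theorem ι_mul_mem_extPow {i j : ℤ} (h : i + 1 = j) (m : M) {x : ExteriorAlgebra R M}
    (hx : x ∈ extPow R M i) : ExteriorAlgebra.ι R m * x ∈ extPow R M j := by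
  subst h
  cases i with
  | ofNat k =>
    change ExteriorAlgebra.ι R m * x ∈ LinearMap.range (ExteriorAlgebra.ι R (M := M)) ^ (k + 1)
    change x ∈ ⋀[R]^k M at hx
    rw [pow_succ']
    exact Submodule.mul_mem_mul ⟨m, rfl⟩ hx
  | negSucc k =>
    have h0 : x = 0 := hx
    rw [h0, mul_zero]
    exact Submodule.zero_mem _

/-- The wedge product `m ∧ ω` of `m ∈ M` and `ω ∈ ⋀ⁱ M`, as a bilinear map to `⋀ʲ M`, where
`j = i + 1`. -/
def wedge {i j : ℤ} (h : i + 1 = j) : M →ₗ[R] extPow R M i →ₗ[R] extPow R M j :=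
  LinearMap.mk₂ R (fun m x => ⟨ExteriorAlgebra.ι R m * x, ι_mul_mem_extPow h m x.2⟩)
    (fun _ _ _ => Subtype.ext (by simp [add_mul]))
    (fun _ _ _ => Subtype.ext (by simp))
    (fun _ _ _ => Subtype.ext (by simp [mul_add]))
    (fun _ _ _ => Subtype.ext (by simp))

@[simp]
theorem coe_wedge {i j : ℤ} (h : i + 1 = j) (m : M) (x : extPow R M i) :
    (wedge h m x : ExteriorAlgebra R M) = ExteriorAlgebra.ι R m * x := rfl

theorem wedge_wedge_self {i j k : ℤ} (h : i + 1 = j) (h' : j + 1 = k) (m : M)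
    (x : extPow R M i) : wedge h' m (wedge h m x) = 0 :=
  Subtype.ext (by simp [← mul_assoc])

theorem wedge_wedge_comm {i j k : ℤ} (h : i + 1 = j) (h' : j + 1 = k) (m m' : M)
    (x : extPow R M i) : wedge h' m (wedge h m' x) + wedge h' m' (wedge h m x) = 0 := by
  have := wedge_wedge_self h h' (m + m') x
  simpa [wedge_wedge_self] using this

variable (R M) in
/-- The complex `(⋀ M, m ∧ ·)`, with `⋀ⁱ M` in degree `i`. -/
noncomputable def wedgeComplex (m : M) : CochainComplex (ModuleCat.{u} R) ℤ where
  X i := ModuleCat.of R (extPow R M i)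
  d i j := if h : i + 1 = j then ModuleCat.ofHom (wedge h m) else 0
  shape i j h := dif_neg h
  d_comp_d' i j k h h' := by
    have h1 : i + 1 = j := h
    have h2 : j + 1 = k := h'
    rw [dif_pos h1, dif_pos h2]
    ext1
    exact LinearMap.ext fun x => wedge_wedge_self h1 h2 m x

variable (S : Type u) [CommRing S] [Algebra R S]

/-- The product `(m ⊗ a) ∧ (ω ⊗ b) = (m ∧ ω) ⊗ a b`, from `M ⊗ S` and `⋀ⁱ M ⊗ S` to `⋀ʲ M ⊗ S`,
where `j = i + 1`. -/
noncomputable def wedgeTensor {i j : ℤ} (h : i + 1 = j) :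
    (M ⊗[R] S) →ₗ[R] (extPow R M i ⊗[R] S) →ₗ[R] (extPow R M j ⊗[R] S) :=
  TensorProduct.map₂ (wedge h) (LinearMap.mul R S)

@[simp]
theorem wedgeTensor_tmul {i j : ℤ} (h : i + 1 = j) (m : M) (a : S) (x : extPow R M i) (b : S) :
    wedgeTensor S h (m ⊗ₜ[R] a) (x ⊗ₜ[R] b) = wedge h m x ⊗ₜ[R] (a * b) := rfl

theorem wedgeTensor_wedgeTensor_comm {i j k : ℤ} (h : i + 1 = j) (h' : j + 1 = k)
    (s t : M ⊗[R] S) (x : extPow R M i ⊗[R] S) :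
    wedgeTensor S h' s (wedgeTensor S h t x) + wedgeTensor S h' t (wedgeTensor S h s x) = 0 := by
  induction s with
  | zero => simp
  | add s₁ s₂ h₁ h₂ =>
    simp only [map_add, LinearMap.add_apply]
    rw [add_add_add_comm, h₁, h₂, add_zero]
  | tmul m a =>
    induction t with
    | zero => simp
    | add t₁ t₂ h₁ h₂ =>
      simp only [map_add, LinearMap.add_apply]
      rw [add_add_add_comm, h₁, h₂, add_zero]
    | tmul m' a' =>
      induction x with
      | zero => simp
      | add x₁ x₂ h₁ h₂ =>
        simp only [map_add]
        rw [add_add_add_comm, h₁, h₂, add_zero]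
      | tmul x b =>
        simp only [wedgeTensor_tmul]
        rw [mul_left_comm a' a b, ← TensorProduct.add_tmul, wedge_wedge_comm,
          TensorProduct.zero_tmul]

theorem wedgeTensor_wedgeTensor_self {i j k : ℤ} (h : i + 1 = j) (h' : j + 1 = k)
    (s : M ⊗[R] S) (x : extPow R M i ⊗[R] S) :
    wedgeTensor S h' s (wedgeTensor S h s x) = 0 := by
  induction s with
  | zero => simp
  | add s₁ s₂ h₁ h₂ =>
    have := wedgeTensor_wedgeTensor_comm S h h' s₁ s₂ x
    simp only [map_add, LinearMap.add_apply, h₁, h₂, zero_add, add_zero]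
    rwa [add_comm]
  | tmul m a =>
    induction x with
    | zero => simp
    | add x₁ x₂ h₁ h₂ => simp only [map_add, h₁, h₂, add_zero]
    | tmul x b => simp [wedge_wedge_self]

/-- The complex `(⋀ M ⊗ S, s ∧ ·)`, with `⋀ⁱ M ⊗ S` in degree `i`, as a complex of
`R`-modules. -/
noncomputable def wedgeTensorComplex (s : M ⊗[R] S) : CochainComplex (ModuleCat.{u} R) ℤ where
  X i := ModuleCat.of R (extPow R M i ⊗[R] S)
  d i j := if h : i + 1 = j then ModuleCat.ofHom (wedgeTensor S h s) else 0
  shape i j h := dif_neg h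
  d_comp_d' i j k h h' := by
    have h1 : i + 1 = j := h
    have h2 : j + 1 = k := h'
    rw [dif_pos h1, dif_pos h2]
    ext1
    exact LinearMap.ext fun x => wedgeTensor_wedgeTensor_self S h1 h2 s x

end Wedge

/-- The complex `C[-r]` with `C[-r]ⁱ = Cⁱ⁻ʳ` and the same differential (no sign). -/
noncomputable def shiftDown {R : Type u} [CommRing R] (C : CochainComplex (ModuleCat.{u} R) ℤ)
    (r : ℤ) : CochainComplex (ModuleCat.{u} R) ℤ where
  X i := C.X (i - r)
  d i j := C.d (i - r) (j - r)
  shape i j h := C.shape _ _ fun h' => h (by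
    have h1 : i - r + 1 = j - r := h'
    change i + 1 = j
    lia)
  d_comp_d' i j k _ _ := C.d_comp_d _ _ _

section Lagrange

variable (K : Type v) {A : Type u} [Field K] [CommRing A] [Algebra K A] {r : ℕ}

/-- `B = A / (g₁, …, gᵣ)`. -/
abbrev Quot (g : Fin r → A) : Type u := A ⧸ Ideal.span (Set.range g)

/-- `B[y] = B[y₁, …, yᵣ]`. -/
abbrev QuotPoly (g : Fin r → A) : Type u := MvPolynomial (Fin r) (Quot g)

/-- The complex of `A`-modules `(Ω_{B/K}, d f̄ ∧ ·)`, where `f̄` is the image of `f` in `B`. -/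
noncomputable def omegaQuot (f : A) (g : Fin r → A) : CochainComplex (ModuleCat.{u} A) ℤ :=
  ((ModuleCat.restrictScalars (algebraMap A (Quot g))).mapHomologicalComplex _).obj
    (wedgeComplex (Quot g) (Ω[Quot g⁄K])
      (KaehlerDifferential.D K (Quot g) (algebraMap A (Quot g) f)))

/-- `dF = df ⊗ 1 + ∑ dgᵢ ⊗ yᵢ` in `Ω¹_{A/K} ⊗ B[y]`. -/
noncomputable def dLagrange (f : A) (g : Fin r → A) : Ω[A⁄K] ⊗[A] QuotPoly g :=
  KaehlerDifferential.D K A f ⊗ₜ[A] 1 +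
    ∑ i, KaehlerDifferential.D K A (g i) ⊗ₜ[A] MvPolynomial.X i

/-- The complex of `A`-modules `(Ω_{A/K} ⊗ B[y], dF ∧ ·)`. -/
noncomputable def omegaTensor (f : A) (g : Fin r → A) : CochainComplex (ModuleCat.{u} A) ℤ :=
  wedgeTensorComplex (QuotPoly g) (dLagrange K f g)

/-- `F_d B[y]`: the polynomials of total degree at most `d`; this is zero for `d < 0`. -/
noncomputable def polyFiltration (g : Fin r → A) (d : ℤ) : Submodule A (QuotPoly g) :=
  (MvPolynomial.restrictSupport (Quot g)
    {m : Fin r →₀ ℕ | ((m.degree : ℕ) : ℤ) ≤ d}).restrictScalars A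

/-- The filtration `F_d (Ωᵏ_{A/K} ⊗ B[y]) = Ωᵏ_{A/K} ⊗ F_{d+k} B[y]`. -/
noncomputable def filtration (g : Fin r → A) (d k : ℤ) :
    Submodule A (extPow A (Ω[A⁄K]) k ⊗[A] QuotPoly g) :=
  LinearMap.range ((polyFiltration g (d + k)).subtype.lTensor (extPow A (Ω[A⁄K]) k))

/-- `Lᵏ`: the elements `ξ` of `F_{-k} (Ωᵏ_{A/K} ⊗ B[y])` for which `dF ∧ ξ` lies in
`F_{-k-1} (Ωᵏ⁺¹_{A/K} ⊗ B[y])`. -/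
noncomputable def L (f : A) (g : Fin r → A) (k : ℤ) :
    Submodule A ((omegaTensor K f g).X k) :=
  filtration K g (-k) k ⊓
    (filtration K g (-k - 1) (k + 1)).comap ((omegaTensor K f g).d k (k + 1)).hom

end Lagrange

end LagrangeKoszul

/-!
Write `M = Ω_{A/K}`, `S = B[y]`, `eⱼ = dgⱼ` and `w = df`, so that the differential of the big complex
is multiplication by `w + ∑ eⱼ yⱼ` in the algebra `⋀ M ⊗ S`.

*Splitting.* As `B` is smooth, `I/I²` is a direct summand of `B ⊗ M`, hence projective, and it is
generated by the `r` classes of the `gⱼ`. These are a basis: a relation `∑ aⱼ gⱼ ∈ I²` with `aⱼ`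
outside a minimal prime `p` of `I` would make `p` minimal over the ideal of the remaining `gᵢ`,
against Krull's height theorem (`coeff_mem_of_sum_mem_sq`). So all relations have nilpotent
coefficients; the module of relations is a direct summand of `Bʳ`, and Nakayama's lemma kills it.
Since `M` is projective, the coordinates lift to functionals `θⱼ : M → A` with `θⱼ(eᵢ) ≡ δᵢⱼ` mod `I`,
and `m ↦ 1 ⊗ m - ∑ θⱼ(m) ⊗ eⱼ` factors through a section `σ : Ω_{B/K} → B ⊗ M`
(`exists_conormal_splitting`).

*Homotopy.* Contraction `Cⱼ` with `θⱼ` satisfies `d Cⱼ + Cⱼ d = zⱼ`, where `zⱼ = yⱼ + θⱼ(w)`. Compose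
it with the divided difference `p ↦ (p - εⱼ p) / zⱼ`, where `εⱼ` substitutes the root of `zⱼ` for
`yⱼ`. This homotopy joins the identity to the projection `eⱼ Cⱼ εⱼ` (`exists_homotopy`), in every
characteristic. Applying the `r` projections in turn, one replaces any cocycle by a cohomologous
element that is constant in `y` and killed by all `eⱼ ∧ ·` (`exists_normalized`). These elements
form `L`, and the same argument applied to an element with normalized boundary shows that a
boundary lying in `L` is a boundary in `L`.

*Identification of `L`.* The section `σ` extends to a ring homomorphism `⋀ Ω_{B/K} → ⋀ M ⊗ B`, and
the map of the theorem is `ω ↦ σ(ω) ∧ e₁ ∧ ⋯ ∧ eᵣ`; with the `eⱼ` on the right, no signs appear in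
the comparison of the differentials. Contracting with the `θⱼ` shows that the map is injective and
that every element killed by all `eⱼ` is in its image (`eq_zero_of_extLift_mul_vecProd_eq_zero`,
`exists_extLift_mul_vecProd_eq`).
-/

namespace LagrangeKoszul

universe u v

/-! ### The conormal module and its splitting -/

section CommAlg

variable {A : Type u} [CommRing A] {r : ℕ}

/-- If a minimal prime `p` of `I = (g₁, …, gᵣ)` has height at least `r`, then the coefficients of
any relation `∑ aᵢ gᵢ ∈ I²` lie in `p`. -/
theorem coeff_mem_of_sum_mem_sq [IsNoetherianRing A] (g : Fin r → A) {p : Ideal A}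
    (hp : p ∈ (Ideal.span (Set.range g)).minimalPrimes) (hh : (r : ℕ∞) ≤ p.height)
    {a : Fin r → A} (ha : ∑ i, a i * g i ∈ Ideal.span (Set.range g) ^ 2) (j : Fin r) :
    a j ∈ p := by
  classical
  by_contra hj
  have hpp : p.IsPrime := hp.isPrime
  set s : Finset A := (Finset.univ.erase j).image g with hs
  have hsp : ∀ i ≠ j, g i ∈ Ideal.span (s : Set A) := fun i hi =>
    Ideal.subset_span (by simpa [hs] using ⟨i, hi, rfl⟩)
  have hI : Ideal.span (Set.range g) = Ideal.span (s : Set A) ⊔ Ideal.span {g j} := by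
    apply le_antisymm
    · rw [Ideal.span_le]
      rintro _ ⟨i, rfl⟩
      by_cases hi : i = j
      · subst hi
        exact Ideal.mem_sup_right (Ideal.mem_span_singleton_self _)
      · exact Ideal.mem_sup_left (hsp i hi)
    · refine sup_le (Ideal.span_mono ?_) (Ideal.span_mono ?_)
      · intro x hx
        simp only [hs, Finset.coe_image] at hx
        exact Set.image_subset_range _ _ hx
      · rintro _ rfl
        exact ⟨j, rfl⟩
  have hgp : ∀ i, g i ∈ p := fun i => hp.1.2 (Ideal.subset_span ⟨i, rfl⟩)
  -- `p` is already minimal over the ideal generated by the `g i` with `i ≠ j`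
  have hmin : p ∈ (Ideal.span (s : Set A)).minimalPrimes := by
    refine ⟨⟨hpp, le_trans (hI ▸ le_sup_left) hp.1.2⟩, ?_⟩
    rintro q ⟨hq, hsq⟩ hqp
    refine hp.2 ⟨hq, ?_⟩ hqp
    rw [hI]
    refine sup_le hsq ((Ideal.span_singleton_le_iff_mem _).2 ?_)
    have hsq2 : Ideal.span (Set.range g) ^ 2 ≤ q ⊔ Ideal.span {g j * g j} := by
      rw [hI, pow_two, Ideal.sup_mul, Ideal.mul_sup (Ideal.span {g j}),
        Ideal.span_singleton_mul_span_singleton]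
      exact sup_le (le_trans Ideal.mul_le_left (le_trans hsq le_sup_left))
        (sup_le_sup_right (le_trans Ideal.mul_le_right hsq) _)
    have h1 : a j * g j ∈ q ⊔ Ideal.span {g j * g j} := by
      have h2 := hsq2 ha
      rw [← Finset.add_sum_erase _ _ (Finset.mem_univ j)] at h2
      refine (Ideal.add_mem_iff_left _ (Ideal.mem_sup_left ?_)).1 h2
      exact sum_mem fun i hi => q.mul_mem_left _ (hsq (hsp i (Finset.ne_of_mem_erase hi)))
    obtain ⟨y, hy, z, hz, hyz⟩ := Submodule.mem_sup.1 h1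
    obtain ⟨c, rfl⟩ := Ideal.mem_span_singleton'.1 hz
    have h3 : (a j - c * g j) * g j ∈ q := by
      have : (a j - c * g j) * g j = y := by linear_combination -hyz
      rwa [this]
    refine (hq.mem_or_mem h3).resolve_left fun h4 => hj ?_
    have h5 := p.add_mem (hqp h4) (p.mul_mem_left c (hgp j))
    rwa [sub_add_cancel] at h5
  have hle := hh.trans (Ideal.height_le_card_of_mem_minimalPrimes_span_finset hmin)
  have hcard : s.card ≤ r - 1 := by
    refine Finset.card_image_le.trans ?_
    simp [Finset.card_erase_of_mem]
  have hr : 0 < r := j.pos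
  have : r ≤ s.card := by exact_mod_cast hle
  omega

/-- Nakayama: an idempotent endomorphism of `Bʳ` whose values have nilpotent coordinates is zero. -/
theorem eq_zero_of_idempotent_of_nilpotent_coeff {B : Type u} [CommRing B]
    (e : (Fin r → B) →ₗ[B] (Fin r → B)) (he : ∀ x, e (e x) = e x)
    (hn : ∀ x i, IsNilpotent (e x i)) : e = 0 := by
  have hle : LinearMap.range e ≤ nilradical B • LinearMap.range e := by
    rintro _ ⟨x, rfl⟩
    have : e x = ∑ i, e x i • e (Pi.single i 1) := by
      conv_lhs => rw [← he x, pi_eq_sum_univ' (e x)]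
      rw [map_sum]
      exact Finset.sum_congr rfl fun i _ => by
        rw [map_smul]
    rw [this]
    exact sum_mem fun i _ => Submodule.smul_mem_smul (hn x i) ⟨_, rfl⟩
  have hfg : (LinearMap.range e).FG := by
    rw [← Submodule.map_top]
    exact Submodule.FG.map _ Module.Finite.fg_top
  have := Submodule.eq_bot_of_le_smul_of_le_jacobson_bot _ _ hfg hle
    (Ideal.radical_le_jacobson)
  exact LinearMap.range_eq_bot.1 this

/-- The conormal sequence of a smooth quotient, with a retraction. The ideal `I` is a variable, as
`A ⧸ I` and `A ⧸ RingHom.ker (algebraMap A (A ⧸ I))` are not definitionally equal. -/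
theorem exists_cotangent_split (K : Type v) [Field K] {B : Type u} [CommRing B] [Algebra K A]
    [Algebra K B] [Algebra A B] [IsScalarTower K A B] [Algebra.FormallySmooth K A]
    [Algebra.FormallySmooth K B] (hs : Function.Surjective (algebraMap A B)) (I : Ideal A)
    (hI : RingHom.ker (algebraMap A B) = I) :
    ∃ (i : I.Cotangent →ₗ[A] B ⊗[A] Ω[A⁄K]) (l : B ⊗[A] Ω[A⁄K] →ₗ[A] I.Cotangent),
      l ∘ₗ i = LinearMap.id ∧
        (∀ x : I, i (I.toCotangent x) = 1 ⊗ₜ KaehlerDifferential.D K A x) ∧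
        Function.Exact i (KaehlerDifferential.mapBaseChange K A B) := by
  subst hI
  obtain ⟨l, hl⟩ := (Algebra.FormallySmooth.iff_split_injection (R := K) hs).1 inferInstance
  exact ⟨KaehlerDifferential.kerCotangentToTensor K A B, l, hl, fun _ => rfl,
    KaehlerDifferential.exact_kerCotangentToTensor_mapBaseChange K A B hs⟩

variable (K : Type v) [Field K] [Algebra K A]

/-- `B`-linear functionals on `B ⊗ Ω_{A/K}` that are dual to the `dgⱼ`, where the `dgⱼ` generate the
kernel of `B ⊗ Ω_{A/K} → Ω_{B/K}`. -/
theorem exists_conormal_coordinates [Algebra.Smooth K A] (g : Fin r → A)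
    [Algebra.Smooth K (Quot g)]
    (hr : ∀ p ∈ (Ideal.span (Set.range g)).minimalPrimes, (r : ℕ∞) ≤ p.height) :
    ∃ t : Quot g ⊗[A] Ω[A⁄K] →ₗ[Quot g] (Fin r → Quot g),
      (∀ j, t (1 ⊗ₜ KaehlerDifferential.D K A (g j)) = Pi.single j 1) ∧
      ∀ x, KaehlerDifferential.mapBaseChange K A (Quot g) x = 0 →
        x = ∑ j, t x j • (1 ⊗ₜ KaehlerDifferential.D K A (g j)) := by
  have hN : IsNoetherianRing A := Algebra.FiniteType.isNoetherianRing K A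
  have hsurj : Function.Surjective (algebraMap A (Quot g)) := Ideal.Quotient.mk_surjective
  obtain ⟨i, l, hli, hi, hex⟩ := exists_cotangent_split K (B := Quot g) hsurj
    (Ideal.span (Set.range g)) (Ideal.mk_ker)
  set I := Ideal.span (Set.range g) with hIdef
  let i' : I.Cotangent →ₗ[Quot g] Quot g ⊗[A] Ω[A⁄K] := i.extendScalarsOfSurjective hsurj
  let l' : Quot g ⊗[A] Ω[A⁄K] →ₗ[Quot g] I.Cotangent := l.extendScalarsOfSurjective hsurj
  have hli' : l' ∘ₗ i' = LinearMap.id := LinearMap.ext fun x => LinearMap.congr_fun hli x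
  have hproj : Module.Projective (Quot g) I.Cotangent := Module.Projective.of_split i' l' hli'
  have hgI : ∀ j, g j ∈ I := fun j => Ideal.subset_span ⟨j, rfl⟩
  let s : (Fin r → Quot g) →ₗ[Quot g] I.Cotangent :=
    Fintype.linearCombination (Quot g) fun j => I.toCotangent ⟨g j, hgI j⟩
  have hs_apply : ∀ a : Fin r → A, s (fun j => algebraMap A (Quot g) (a j)) =
      I.toCotangent ⟨∑ j, a j * g j, sum_mem fun j _ => I.mul_mem_left _ (hgI j)⟩ := by
    intro a
    have : (⟨∑ j, a j * g j, sum_mem fun j _ => I.mul_mem_left _ (hgI j)⟩ : I) =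
        ∑ j, a j • (⟨g j, hgI j⟩ : I) := Subtype.ext (by simp)
    rw [this, map_sum]
    simp only [s, Fintype.linearCombination_apply, map_smul, algebraMap_smul]
  have hs : Function.Surjective s := by
    intro x
    obtain ⟨⟨x, hx⟩, rfl⟩ := I.toCotangent_surjective x
    obtain ⟨a, rfl⟩ := (Ideal.mem_span_range_iff_exists_fun).1 hx
    exact ⟨_, hs_apply a⟩
  obtain ⟨q, hq⟩ := Module.projective_lifting_property s LinearMap.id hs
  have hq' : ∀ x, s (q x) = x := fun x => LinearMap.congr_fun hq x
  -- `id - q ∘ s` is the projection of `Bʳ` onto the module of relations between the `g j`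
  have he : LinearMap.id - q ∘ₗ s = 0 := by
    apply eq_zero_of_idempotent_of_nilpotent_coeff
    · intro x
      simp [hq']
    · intro x j
      have hx : s ((LinearMap.id - q ∘ₗ s : _ →ₗ[Quot g] _) x) = 0 := by simp [hq']
      generalize (LinearMap.id - q ∘ₗ s : _ →ₗ[Quot g] _) x = b at hx ⊢
      choose a ha using fun j => hsurj (b j)
      obtain rfl : (fun j => algebraMap A (Quot g) (a j)) = b := funext ha
      rw [hs_apply, Ideal.toCotangent_eq_zero] at hx
      change algebraMap A (Quot g) (a j) ∈ nilradical (Quot g)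
      have hrad : a j ∈ I.radical := by
        rw [← Ideal.sInf_minimalPrimes, Ideal.mem_sInf]
        intro p hp
        exact coeff_mem_of_sum_mem_sq g hp (hr p hp) hx j
      obtain ⟨n, hn⟩ := hrad
      refine ⟨n, ?_⟩
      rw [← map_pow]
      exact Ideal.Quotient.eq_zero_iff_mem.2 hn
  have hqs : ∀ x, q (s x) = x := fun x => by
    exact (sub_eq_zero.1 (LinearMap.congr_fun he x)).symm
  have hsj : ∀ j, s (Pi.single j 1) = I.toCotangent ⟨g j, hgI j⟩ := fun j => by
    simp [s]
  refine ⟨q ∘ₗ l', fun j => ?_, fun x hx => ?_⟩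
  · have : l' (1 ⊗ₜ KaehlerDifferential.D K A (g j)) = s (Pi.single j 1) := by
      rw [hsj, ← hi ⟨g j, hgI j⟩]
      exact LinearMap.congr_fun hli (I.toCotangent ⟨g j, hgI j⟩)
    rw [LinearMap.comp_apply, this, hqs]
  · obtain ⟨y, rfl⟩ := (hex x).1 hx
    have h1 : l' (i y) = y := LinearMap.congr_fun hli y
    rw [LinearMap.comp_apply, h1]
    conv_lhs => rw [← hq' y]
    change i' (s (q y)) = _
    simp only [s, Fintype.linearCombination_apply, map_sum, map_smul]
    refine Finset.sum_congr rfl fun j _ => ?_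
    congr 1
    exact hi _

/-- The functionals `θⱼ` on `Ω_{A/K}`, dual to the `dgⱼ` modulo `I`, and the section `σ` of
`B ⊗ Ω_{A/K} → Ω_{B/K}` whose image is killed by the `θⱼ`. -/
theorem exists_conormal_splitting [Algebra.Smooth K A] (g : Fin r → A)
    [Algebra.Smooth K (Quot g)]
    (hr : ∀ p ∈ (Ideal.span (Set.range g)).minimalPrimes, (r : ℕ∞) ≤ p.height) :
    ∃ (θ : Fin r → Module.Dual A (Ω[A⁄K])) (σ : Ω[Quot g⁄K] →ₗ[Quot g] Quot g ⊗[A] Ω[A⁄K]),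
      (∀ i j, algebraMap A (Quot g) (θ j (KaehlerDifferential.D K A (g i))) =
        if i = j then 1 else 0) ∧
      ∀ m : Ω[A⁄K], σ (KaehlerDifferential.map K K A (Quot g) m) =
        1 ⊗ₜ m - ∑ j, θ j m • (1 ⊗ₜ KaehlerDifferential.D K A (g j)) := by
  obtain ⟨t, ht, hker⟩ := exists_conormal_coordinates K g hr
  have hsurj : Function.Surjective (algebraMap A (Quot g)) := Ideal.Quotient.mk_surjective
  have hlift : ∀ j, ∃ θ : Ω[A⁄K] →ₗ[A] A, Algebra.linearMap A (Quot g) ∘ₗ θ =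
      LinearMap.proj j ∘ₗ t.restrictScalars A ∘ₗ TensorProduct.mk A (Quot g) (Ω[A⁄K]) 1 :=
    fun j => Module.projective_lifting_property _ _ hsurj
  choose θ hθ using hlift
  have hθ' : ∀ j m, algebraMap A (Quot g) (θ j m) = t (1 ⊗ₜ m) j :=
    fun j m => LinearMap.congr_fun (hθ j) m
  let ρ := KaehlerDifferential.mapBaseChange K A (Quot g)
  have hρ : Function.Surjective ρ := KaehlerDifferential.mapBaseChange_surjective K A _ hsurj
  let P : Quot g ⊗[A] Ω[A⁄K] →ₗ[Quot g] Quot g ⊗[A] Ω[A⁄K] :=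
    LinearMap.id - Fintype.linearCombination (Quot g)
      (fun j => (1 : Quot g) ⊗ₜ[A] KaehlerDifferential.D K A (g j)) ∘ₗ t
  have hP : ∀ x, P x = x - ∑ j, t x j • (1 ⊗ₜ KaehlerDifferential.D K A (g j)) := fun x => by
    simp [P, Fintype.linearCombination_apply]
  have hPker : LinearMap.ker ρ ≤ LinearMap.ker P := fun x hx => by
    rw [LinearMap.mem_ker, hP, ← hker x hx, sub_self]
  let σ := (LinearMap.ker ρ).liftQ P hPker ∘ₗ (ρ.quotKerEquivOfSurjective hρ).symm.toLinearMap
  have hσ : ∀ x, σ (ρ x) = P x := fun x => by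
    have : (ρ.quotKerEquivOfSurjective hρ).symm (ρ x) = Submodule.Quotient.mk x := by
      rw [LinearEquiv.symm_apply_eq]
      rfl
    simp only [σ, LinearMap.comp_apply, LinearEquiv.coe_coe, this]
    rfl
  refine ⟨θ, σ, fun i j => ?_, fun m => ?_⟩
  · rw [hθ', ht, Pi.single_apply]
    simp only [eq_comm]
  · have : KaehlerDifferential.map K K A (Quot g) m = ρ (1 ⊗ₜ m) := by
      simp [ρ]
    rw [this, hσ, hP]
    simp only [← hθ', algebraMap_smul]

end CommAlg

/-! ### The algebra `⋀ M ⊗ S`, wedge products and contractions -/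

section ExtTensor

variable {A : Type u} [CommRing A] {M : Type u} [AddCommGroup M] [Module A M]

theorem contractLeft_mem_extPow (θ : Module.Dual A M) {i j : ℤ} (h : i + 1 = j)
    {x : ExteriorAlgebra A M} (hx : x ∈ extPow A M j) :
    CliffordAlgebra.contractLeft θ x ∈ extPow A M i := by
  subst h
  have key : ∀ (k : ℕ) {x : ExteriorAlgebra A M}, x ∈ ⋀[A]^k M →
      CliffordAlgebra.contractLeft θ x ∈ extPow A M ((k : ℤ) - 1) := by
    intro k x hx
    induction hx using Submodule.pow_induction_on_left' with
    | algebraMap a =>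
      rw [show algebraMap A (ExteriorAlgebra A M) a = algebraMap A (CliffordAlgebra 0) a from rfl,
        CliffordAlgebra.contractLeft_algebraMap]
      exact Submodule.zero_mem _
    | add x y i hx hy h₁ h₂ =>
      rw [map_add]
      exact Submodule.add_mem _ h₁ h₂
    | mem_mul m hm i x hx ih =>
      obtain ⟨m, rfl⟩ := hm
      have h1 := CliffordAlgebra.contractLeft_ι_mul θ (Q := 0) m x
      rw [show ExteriorAlgebra.ι A m * x = CliffordAlgebra.ι 0 m * x from rfl, h1]
      have h2 : (((i + 1 : ℕ) : ℤ) - 1) = i := by push_cast; ring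
      rw [h2]
      exact Submodule.sub_mem _ (Submodule.smul_mem _ _ hx)
        (ι_mul_mem_extPow (by ring) m ih)
  match i with
  | Int.ofNat k =>
    have := key (k + 1) hx
    rwa [show (((k + 1 : ℕ) : ℤ) - 1) = Int.ofNat k by simp] at this
  | Int.negSucc 0 => exact key 0 hx
  | Int.negSucc (k + 1) =>
    have h0 : x = 0 := hx
    rw [h0, map_zero]
    exact Submodule.zero_mem _

/-- Elements of degree `i` commute with vectors up to a sign `c` that depends on `i` only. -/
theorem exists_mul_ι_eq_smul (i : ℤ) : ∃ c : A, c * c = 1 ∧ ∀ x ∈ extPow A M i, ∀ m : M,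
    x * ExteriorAlgebra.ι A m = c • (ExteriorAlgebra.ι A m * x) := by
  match i with
  | Int.negSucc k =>
    refine ⟨1, one_mul _, fun x hx m => ?_⟩
    have h0 : x = 0 := hx
    simp [h0]
  | Int.ofNat k =>
    refine ⟨(-1) ^ k, by rw [← mul_pow]; simp, fun x hx m => ?_⟩
    change x ∈ ⋀[A]^k M at hx
    induction hx using Submodule.pow_induction_on_left' with
    | algebraMap a => simp [Algebra.commutes]
    | add x y i hx hy h₁ h₂ => rw [add_mul, h₁, h₂, mul_add, smul_add]
    | mem_mul n hn i x hx ih =>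
      obtain ⟨n, rfl⟩ := hn
      have h2 : ExteriorAlgebra.ι A n * ExteriorAlgebra.ι A m =
          - (ExteriorAlgebra.ι A m * ExteriorAlgebra.ι A n) := by
        rw [eq_neg_iff_add_eq_zero]
        exact ExteriorAlgebra.ι_add_mul_swap n m
      rw [mul_assoc, ih, mul_smul_comm, ← mul_assoc, h2, pow_succ]
      simp [mul_assoc]

variable (A M) in
/-- `⋀ⁱ M` is a direct summand of `⋀ M`, so that `⋀ⁱ M ⊗ S → ⋀ M ⊗ S` is injective although `S`
need not be flat. -/
theorem exists_extPow_retraction (i : ℤ) : ∃ p : ExteriorAlgebra A M →ₗ[A] extPow A M i,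
    p ∘ₗ (extPow A M i).subtype = LinearMap.id := by
  match i with
  | Int.negSucc k =>
    refine ⟨0, LinearMap.ext fun x => ?_⟩
    have h0 : (x : ExteriorAlgebra A M) = 0 := x.2
    exact Subtype.ext h0.symm
  | Int.ofNat k =>
    refine ⟨(DirectSum.component A ℕ (fun i : ℕ => ⋀[A]^i M) k) ∘ₗ
      (DirectSum.decomposeLinearEquiv (fun i : ℕ => ⋀[A]^i M)).toLinearMap,
        LinearMap.ext fun x => ?_⟩
    change (DirectSum.decompose (fun i : ℕ => ⋀[A]^i M) (x : ExteriorAlgebra A M)) k = x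
    exact Subtype.ext (DirectSum.decompose_of_mem_same _ x.2)

variable (S : Type u) [CommRing S] [Algebra A S]

variable (A M) in
/-- The algebra `⋀ M ⊗ S`. -/
abbrev ExtTensor : Type u := ExteriorAlgebra A M ⊗[A] S

/-- The map `M ⊗ S → ⋀ M ⊗ S`. -/
noncomputable def ιTensor : M ⊗[A] S →ₗ[A] ExtTensor A M S :=
  (ExteriorAlgebra.ι A).rTensor S

@[simp]
theorem ιTensor_tmul (m : M) (s : S) :
    ιTensor S (m ⊗ₜ[A] s) = ExteriorAlgebra.ι A m ⊗ₜ[A] s := rfl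

/-- The contraction with a functional on `M`, extended `S`-linearly to `⋀ M ⊗ S`. -/
noncomputable def contr (θ : Module.Dual A M) : ExtTensor A M S →ₗ[A] ExtTensor A M S :=
  LinearMap.rTensor S (CliffordAlgebra.contractLeft (Q := 0) θ)

@[simp]
theorem contr_tmul (θ : Module.Dual A M) (x : ExteriorAlgebra A M) (s : S) :
    contr S θ (x ⊗ₜ[A] s) = CliffordAlgebra.contractLeft (Q := 0) θ x ⊗ₜ[A] s := rfl

variable (A M) in
/-- The inclusion of `⋀ⁱ M ⊗ S` into the algebra `⋀ M ⊗ S`. -/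
noncomputable def incl (i : ℤ) : extPow A M i ⊗[A] S →ₗ[A] ExtTensor A M S :=
  (extPow A M i).subtype.rTensor S

@[simp]
theorem incl_tmul (i : ℤ) (x : extPow A M i) (s : S) :
    incl A M S i (x ⊗ₜ[A] s) = (x : ExteriorAlgebra A M) ⊗ₜ[A] s := rfl

theorem incl_injective (i : ℤ) : Function.Injective (incl A M S i) := by
  obtain ⟨p, hp⟩ := exists_extPow_retraction A M i
  have : (p.rTensor S) ∘ₗ incl A M S i = LinearMap.id := by
    rw [incl, ← LinearMap.rTensor_comp, hp, LinearMap.rTensor_id]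
  exact Function.LeftInverse.injective fun x => LinearMap.congr_fun this x

variable (A M) in
/-- The part of degree `i` of `⋀ M ⊗ S`. -/
noncomputable def degPart (i : ℤ) : Submodule A (ExtTensor A M S) := LinearMap.range (incl A M S i)

variable {S}

theorem tmul_mem_degPart {i : ℤ} {x : ExteriorAlgebra A M} (hx : x ∈ extPow A M i) (s : S) :
    x ⊗ₜ[A] s ∈ degPart A M S i := ⟨⟨x, hx⟩ ⊗ₜ s, rfl⟩

theorem degPart_induction {i : ℤ} {P : Submodule A (ExtTensor A M S)}
    (h : ∀ x ∈ extPow A M i, ∀ s : S, x ⊗ₜ[A] s ∈ P) : degPart A M S i ≤ P := by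
  rintro _ ⟨x, rfl⟩
  induction x with
  | zero => simp
  | add x y hx hy =>
    rw [map_add]
    exact P.add_mem hx hy
  | tmul x s => exact h _ x.2 s

theorem incl_wedgeTensor {i j : ℤ} (h : i + 1 = j) (s : M ⊗[A] S) (x : extPow A M i ⊗[A] S) :
    incl A M S j (wedgeTensor S h s x) = ιTensor S s * incl A M S i x := by
  induction s with
  | zero => simp
  | add s₁ s₂ h₁ h₂ => simp only [map_add, LinearMap.add_apply, h₁, h₂, add_mul]
  | tmul m a =>
    induction x with
    | zero => simp
    | add x₁ x₂ h₁ h₂ => simp only [map_add, h₁, h₂, mul_add]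
    | tmul x b => simp

theorem ιTensor_mul_mem {i j : ℤ} (h : i + 1 = j) (s : M ⊗[A] S) {x : ExtTensor A M S}
    (hx : x ∈ degPart A M S i) : ιTensor S s * x ∈ degPart A M S j := by
  obtain ⟨x, rfl⟩ := hx
  exact ⟨_, incl_wedgeTensor h s x⟩

theorem contr_mem {i j : ℤ} (h : i + 1 = j) (θ : Module.Dual A M) {x : ExtTensor A M S}
    (hx : x ∈ degPart A M S j) : contr S θ x ∈ degPart A M S i :=
  degPart_induction (P := (degPart A M S i).comap (contr S θ))
    (fun _ hx s => tmul_mem_degPart (contractLeft_mem_extPow θ h hx) s) hx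

theorem lTensor_mem {S' : Type u} [CommRing S'] [Algebra A S'] {i : ℤ} (f : S →ₗ[A] S')
    {x : ExtTensor A M S} (hx : x ∈ degPart A M S i) :
    f.lTensor (ExteriorAlgebra A M) x ∈ degPart A M S' i :=
  degPart_induction (P := (degPart A M S' i).comap (f.lTensor (ExteriorAlgebra A M)))
    (fun _ hx s => tmul_mem_degPart hx (f s)) hx

theorem lTensor_contr {S' : Type u} [CommRing S'] [Algebra A S'] (f : S →ₗ[A] S')
    (θ : Module.Dual A M) (x : ExtTensor A M S) :
    f.lTensor (ExteriorAlgebra A M) (contr S θ x) =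
      contr S' θ (f.lTensor (ExteriorAlgebra A M) x) := by
  induction x using TensorProduct.induction_on with
  | zero => simp
  | add x y hx hy => simp only [map_add, hx, hy]
  | tmul x s => simp

variable (S) in
/-- The vector `m ⊗ 1` of `⋀ M ⊗ S`. -/
noncomputable abbrev vec (m : M) : ExtTensor A M S := ιTensor S (m ⊗ₜ[A] 1)

theorem lTensor_vec_mul {S' : Type u} [CommRing S'] [Algebra A S'] (f : S →ₗ[A] S')
    (m : M) (x : ExtTensor A M S) :
    f.lTensor (ExteriorAlgebra A M) (vec S m * x) =
      vec S' m * f.lTensor (ExteriorAlgebra A M) x := by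
  induction x using TensorProduct.induction_on with
  | zero => simp
  | add x y hx hy => simp only [map_add, mul_add, hx, hy]
  | tmul x s => simp

theorem ιTensor_tmul_mul (m : M) (s : S) (x : ExtTensor A M S) :
    ιTensor S (m ⊗ₜ[A] s) * x =
      vec S m * (LinearMap.mulLeft A s).lTensor (ExteriorAlgebra A M) x := by
  induction x using TensorProduct.induction_on with
  | zero => simp
  | add x y hx hy => simp only [map_add, mul_add, hx, hy]
  | tmul x s => simp

theorem vec_mul_vec_mul (m n : M) (x : ExtTensor A M S) :
    vec S m * (vec S n * x) = -(vec S n * (vec S m * x)) := by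
  have h : (vec S m * vec S n : ExtTensor A M S) = -(vec S n * vec S m) := by
    rw [eq_neg_iff_add_eq_zero]
    simp only [ιTensor_tmul, Algebra.TensorProduct.tmul_mul_tmul, mul_one,
      ← TensorProduct.add_tmul, ExteriorAlgebra.ι_add_mul_swap, TensorProduct.zero_tmul]
  rw [← mul_assoc, h, neg_mul, mul_assoc]

theorem vec_mul_vec_self_mul (m : M) (x : ExtTensor A M S) : vec S m * (vec S m * x) = 0 := by
  rw [← mul_assoc]
  simp

theorem contr_vec_mul (θ : Module.Dual A M) (m : M) (x : ExtTensor A M S) :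
    contr S θ (vec S m * x) = θ m • x - vec S m * contr S θ x := by
  induction x using TensorProduct.induction_on with
  | zero => simp
  | add x y hx hy =>
    simp only [mul_add, map_add, hx, hy, smul_add]
    abel
  | tmul x s =>
    simp only [ιTensor_tmul, Algebra.TensorProduct.tmul_mul_tmul, one_mul, contr_tmul]
    have := CliffordAlgebra.contractLeft_ι_mul θ (Q := 0) m x
    rw [show ExteriorAlgebra.ι A m * x = CliffordAlgebra.ι 0 m * x from rfl, this,
      TensorProduct.sub_tmul, TensorProduct.smul_tmul']

theorem lTensor_mulLeft_algebraMap (a : A) (x : ExtTensor A M S) :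
    (LinearMap.mulLeft A (algebraMap A S a)).lTensor (ExteriorAlgebra A M) x = a • x := by
  have : LinearMap.mulLeft A (algebraMap A S a) = a • LinearMap.id :=
    LinearMap.ext fun s => by simp [Algebra.smul_def]
  rw [this, LinearMap.lTensor_smul, LinearMap.lTensor_id]
  rfl

theorem smul_eq_of_algebraMap_eq {a b : A} (h : algebraMap A S a = algebraMap A S b)
    (x : ExtTensor A M S) : a • x = b • x := by
  rw [← lTensor_mulLeft_algebraMap, h, lTensor_mulLeft_algebraMap]

theorem exists_mul_vec_eq_smul (i : ℤ) : ∃ c : A, c * c = 1 ∧ ∀ x ∈ degPart A M S i, ∀ m : M,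
    x * vec S m = c • (vec S m * x) := by
  obtain ⟨c, hc, h⟩ := exists_mul_ι_eq_smul (A := A) (M := M) i
  refine ⟨c, hc, fun x hx m => ?_⟩
  let P : Submodule A (ExtTensor A M S) :=
    LinearMap.eqLocus (LinearMap.mulRight A (vec S m)) (c • LinearMap.mulLeft A (vec S m))
  have hP : degPart A M S i ≤ P := degPart_induction fun y hy s => by
    change (y ⊗ₜ[A] s) * vec S m = c • (vec S m * (y ⊗ₜ[A] s))
    simp only [ιTensor_tmul, Algebra.TensorProduct.tmul_mul_tmul, one_mul, mul_one, h y hy m,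
      TensorProduct.smul_tmul']
  exact hP hx

end ExtTensor

/-! ### Divided differences and the Koszul homotopies -/

section DividedDifference

open MvPolynomial

variable {σ : Type*} [DecidableEq σ] {B : Type*} [CommRing B] (c : σ → B)

/-- The substitution of the constant `c i` for the variable `X i`. -/
noncomputable def evalVar (i : σ) : MvPolynomial σ B →ₐ[B] MvPolynomial σ B :=
  aeval (Function.update X i (C (c i)))

theorem evalVar_X (i j : σ) : evalVar c i (X j) = if j = i then C (c i) else X j := by
  simp [evalVar, Function.update_apply]

theorem evalVar_comm (i j : σ) :
    (evalVar c i).comp (evalVar c j) = (evalVar c j).comp (evalVar c i) := by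
  ext k
  simp only [AlgHom.comp_apply, evalVar_X]
  split_ifs <;> simp_all [evalVar_X, ← MvPolynomial.algebraMap_eq]

theorem evalVar_evalVar (i : σ) : (evalVar c i).comp (evalVar c i) = evalVar c i := by
  ext k
  simp only [AlgHom.comp_apply, evalVar_X]
  split_ifs <;> simp_all [evalVar_X, ← MvPolynomial.algebraMap_eq]

omit [DecidableEq σ] in
theorem isLeftRegular_X_sub_C (i : σ) : IsLeftRegular (X i - C (c i) : MvPolynomial σ B) := by
  let τ : MvPolynomial σ B →ₐ[B] MvPolynomial σ B := aeval fun j => X j + C (c j)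
  let τ' : MvPolynomial σ B →ₐ[B] MvPolynomial σ B := aeval fun j => X j - C (c j)
  have h : ∀ p, τ' (τ p) = p := by
    have : τ'.comp τ = AlgHom.id B _ := by
      ext k
      simp [τ, τ', ← MvPolynomial.algebraMap_eq]
    exact DFunLike.congr_fun this
  intro p q hpq
  have h1 := congrArg τ hpq
  simp only [map_mul] at h1
  have h2 : τ (X i - C (c i)) = X i := by simp [τ, ← MvPolynomial.algebraMap_eq]
  rw [h2] at h1
  have h3 := (MvPolynomial.isRegular_X (R := B) (n := i)).left h1
  rw [← h p, ← h q, h3]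

theorem X_sub_C_dvd_sub_evalVar (i : σ) (p : MvPolynomial σ B) :
    (X i - C (c i)) ∣ p - evalVar c i p := by
  induction p using MvPolynomial.induction_on with
  | C a => simp [← MvPolynomial.algebraMap_eq]
  | add p q hp hq =>
    rw [map_add, add_sub_add_comm]
    exact dvd_add hp hq
  | mul_X p j hp =>
    rw [map_mul, evalVar_X]
    split_ifs with hj
    · subst hj
      have : p * X j - evalVar c j p * C (c j) =
          (p - evalVar c j p) * X j + evalVar c j p * (X j - C (c j)) := by ring
      rw [this]
      exact dvd_add (Dvd.dvd.mul_right hp _) (Dvd.intro_left _ rfl)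
    · rw [← sub_mul]
      exact Dvd.dvd.mul_right hp _

/-- The divided difference `Δ p = (p - p|_{X i = c i}) / (X i - c i)`. -/
theorem exists_dividedDifference (i : σ) :
    ∃ Δ : MvPolynomial σ B →ₗ[B] MvPolynomial σ B,
      (∀ p, (X i - C (c i)) * Δ p = p - evalVar c i p) ∧
        ∀ j p, Δ (X j * p) = X j * Δ p + if j = i then evalVar c i p else 0 := by
  choose f hf using X_sub_C_dvd_sub_evalVar c i
  have reg := isLeftRegular_X_sub_C c i
  refine ⟨⟨⟨f, fun p q => reg ?_⟩, fun b p => reg ?_⟩, fun p => (hf p).symm,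
    fun j p => reg ?_⟩
  · change (X i - C (c i)) * _ = (X i - C (c i)) * _
    rw [mul_add, ← hf, ← hf, ← hf, map_add]
    ring
  · change (X i - C (c i)) * _ = (X i - C (c i)) * _
    rw [RingHom.id_apply, mul_smul_comm, ← hf, ← hf, map_smul, smul_sub]
  · change (X i - C (c i)) * f _ = (X i - C (c i)) * (X j * f p + _)
    rw [mul_add, mul_left_comm, ← hf, ← hf, map_mul, evalVar_X]
    split_ifs with hj
    · subst hj
      ring
    · ring

end DividedDifference

section Homotopy

open MvPolynomial

variable {A : Type u} [CommRing A] {M : Type u} [AddCommGroup M] [Module A M]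
  {B : Type u} [CommRing B] [Algebra A B] {r : ℕ}
  (e : Fin r → M) (θ : Fin r → Module.Dual A M) (w : M)

variable (B) in
/-- The element `w ⊗ 1 + ∑ eᵢ ⊗ yᵢ` of `M ⊗ B[y]`. -/
noncomputable def koszulVec : M ⊗[A] MvPolynomial (Fin r) B := w ⊗ₜ 1 + ∑ i, e i ⊗ₜ X i

variable (B) in
/-- The Koszul differential: multiplication by `w ⊗ 1 + ∑ eᵢ ⊗ yᵢ` on `⋀ M ⊗ B[y]`. -/
noncomputable def koszulDiff :
    ExtTensor A M (MvPolynomial (Fin r) B) →ₗ[A] ExtTensor A M (MvPolynomial (Fin r) B) :=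
  LinearMap.mulLeft A (ιTensor _ (koszulVec B e w))

theorem koszulDiff_apply (x : ExtTensor A M (MvPolynomial (Fin r) B)) :
    koszulDiff B e w x = vec _ w * x + ∑ i, vec _ (e i) *
      (LinearMap.mulLeft A (X i)).lTensor (ExteriorAlgebra A M) x := by
  rw [koszulDiff, LinearMap.mulLeft_apply, koszulVec, map_add, map_sum, add_mul, Finset.sum_mul]
  exact congrArg₂ (· + ·) rfl (Finset.sum_congr rfl fun i _ => ιTensor_tmul_mul _ _ _)

/-- The root `-θⱼ(w)` of `yⱼ + θⱼ(w)`, the value of `θⱼ` on `w + ∑ eᵢ yᵢ`. -/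
def koszulRoot (B : Type u) [CommRing B] [Algebra A B] (θ : Fin r → Module.Dual A M) (w : M)
    (j : Fin r) : B := -algebraMap A B (θ j w)

variable (hθ : ∀ i j, algebraMap A B (θ j (e i)) = if i = j then 1 else 0)

include hθ

/-- The scalar `θⱼ(eᵢ) : A` acts as `δᵢⱼ`, because `A` acts through `B`. -/
theorem dual_smul {S : Type u} [CommRing S] [Algebra A S] [Algebra B S] [IsScalarTower A B S]
    (i j : Fin r) (x : ExtTensor A M S) : θ j (e i) • x = if i = j then x else 0 := by
  have h : ∀ a : A, algebraMap A B (θ j (e i)) = algebraMap A B a → θ j (e i) • x = a • x :=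
    fun a ha => smul_eq_of_algebraMap_eq (by
      rw [IsScalarTower.algebraMap_apply A B S, ha, ← IsScalarTower.algebraMap_apply]) x
  split_ifs with hij
  · rw [h 1 (by simp [hθ, hij]), one_smul]
  · rw [h 0 (by simp [hθ, hij]), zero_smul]

/-- Contraction with `θⱼ` is a homotopy from multiplication by `yⱼ + θⱼ(w)` to zero. -/
theorem contr_koszulDiff (j : Fin r) (x : ExtTensor A M (MvPolynomial (Fin r) B)) :
    contr _ (θ j) (koszulDiff B e w x) =
      (LinearMap.mulLeft A (X j - C (koszulRoot B θ w j))).lTensor (ExteriorAlgebra A M) x -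
        koszulDiff B e w (contr _ (θ j) x) := by
  have h : LinearMap.mulLeft A (X j - C (koszulRoot B θ w j)) =
      LinearMap.mulLeft A (X j) +
        LinearMap.mulLeft A (algebraMap A (MvPolynomial (Fin r) B) (θ j w)) := by
    ext p
    simp [koszulRoot, add_mul, IsScalarTower.algebraMap_apply A B (MvPolynomial (Fin r) B),
      MvPolynomial.algebraMap_eq]
  simp only [koszulDiff_apply, map_add, map_sum, contr_vec_mul, dual_smul e θ hθ, h,
    LinearMap.lTensor_add, LinearMap.add_apply, lTensor_mulLeft_algebraMap, lTensor_contr,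
    Finset.sum_sub_distrib, Finset.sum_ite_eq', Finset.mem_univ, if_true]
  abel

omit hθ in
/-- A map `f` of coefficients which commutes with the variables up to `g` in the variable `y j`
commutes with the differential up to `e j ∧ g`. -/
theorem lTensor_koszulDiff (f g : MvPolynomial (Fin r) B →ₗ[A] MvPolynomial (Fin r) B) (j : Fin r)
    (h : ∀ i p, f (X i * p) = X i * f p + if i = j then g p else 0)
    (x : ExtTensor A M (MvPolynomial (Fin r) B)) :
    f.lTensor (ExteriorAlgebra A M) (koszulDiff B e w x) =
      koszulDiff B e w (f.lTensor (ExteriorAlgebra A M) x) +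
        vec _ (e j) * g.lTensor (ExteriorAlgebra A M) x := by
  have h' : ∀ i, f.lTensor (ExteriorAlgebra A M)
      ((LinearMap.mulLeft A (X i)).lTensor (ExteriorAlgebra A M) x) =
      (LinearMap.mulLeft A (X i)).lTensor (ExteriorAlgebra A M)
        (f.lTensor (ExteriorAlgebra A M) x) +
        if i = j then g.lTensor (ExteriorAlgebra A M) x else 0 := fun i => by
    have : f ∘ₗ LinearMap.mulLeft A (X i) =
        LinearMap.mulLeft A (X i) ∘ₗ f + if i = j then g else 0 := by
      refine LinearMap.ext fun p => ?_
      rw [LinearMap.add_apply]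
      split_ifs with hij <;> simp [h, hij]
    rw [← LinearMap.lTensor_comp_apply, this, LinearMap.lTensor_add, LinearMap.add_apply,
      LinearMap.lTensor_comp_apply]
    split_ifs <;> simp
  simp only [koszulDiff_apply, map_add, map_sum, lTensor_vec_mul, h', mul_add,
    Finset.sum_add_distrib, mul_ite, mul_zero, Finset.sum_ite_eq', Finset.mem_univ, if_true]
  abel

omit hθ in
variable (A M) in
/-- The action of an endomorphism of the algebra `B[y]` on `⋀ M ⊗ B[y]`. -/
noncomputable def polyMap (f : MvPolynomial (Fin r) B →ₐ[B] MvPolynomial (Fin r) B) :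
    ExtTensor A M (MvPolynomial (Fin r) B) →ₗ[A] ExtTensor A M (MvPolynomial (Fin r) B) :=
  (f.toLinearMap.restrictScalars A).lTensor (ExteriorAlgebra A M)

omit hθ in
theorem polyMap_comp_apply (f g : MvPolynomial (Fin r) B →ₐ[B] MvPolynomial (Fin r) B)
    (x : ExtTensor A M (MvPolynomial (Fin r) B)) :
    polyMap A M (f.comp g) x = polyMap A M f (polyMap A M g x) :=
  LinearMap.lTensor_comp_apply (ExteriorAlgebra A M) (f.toLinearMap.restrictScalars A)
    (g.toLinearMap.restrictScalars A) x

omit hθ in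
variable (A M B) in
/-- The substitution of the root of `yⱼ + θⱼ(w)` for `yⱼ` in `⋀ M ⊗ B[y]`. -/
noncomputable abbrev evalTensor (θ : Fin r → Module.Dual A M) (w : M) (j : Fin r) :
    ExtTensor A M (MvPolynomial (Fin r) B) →ₗ[A] ExtTensor A M (MvPolynomial (Fin r) B) :=
  polyMap A M (evalVar (koszulRoot B θ w) j)

omit hθ in
theorem evalTensor_comm (i j : Fin r) (x : ExtTensor A M (MvPolynomial (Fin r) B)) :
    evalTensor A M B θ w i (evalTensor A M B θ w j x) =
      evalTensor A M B θ w j (evalTensor A M B θ w i x) := by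
  rw [← polyMap_comp_apply, evalVar_comm, polyMap_comp_apply]

omit hθ in
theorem evalTensor_evalTensor (j : Fin r) (x : ExtTensor A M (MvPolynomial (Fin r) B)) :
    evalTensor A M B θ w j (evalTensor A M B θ w j x) = evalTensor A M B θ w j x := by
  rw [← polyMap_comp_apply, evalVar_evalVar]

omit hθ in
theorem polyMap_vec_mul_contr (f : MvPolynomial (Fin r) B →ₐ[B] MvPolynomial (Fin r) B) (m : M)
    (η : Module.Dual A M) (x : ExtTensor A M (MvPolynomial (Fin r) B)) :
    polyMap A M f (vec _ m * contr _ η x) = vec _ m * contr _ η (polyMap A M f x) := by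
  rw [polyMap, lTensor_vec_mul, lTensor_contr]

/-- The homotopy `h`, contraction with `θⱼ` after the divided difference in `yⱼ`, joins the identity
to the map `eⱼ Cⱼ εⱼ`. -/
theorem exists_homotopy (j : Fin r) :
    ∃ h : ExtTensor A M (MvPolynomial (Fin r) B) →ₗ[A] ExtTensor A M (MvPolynomial (Fin r) B),
      (∀ i k, i + 1 = k → ∀ x ∈ degPart A M (MvPolynomial (Fin r) B) k,
        h x ∈ degPart A M (MvPolynomial (Fin r) B) i) ∧
      ∀ x, koszulDiff B e w (h x) + h (koszulDiff B e w x) =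
        x - vec _ (e j) * contr _ (θ j) (evalTensor A M B θ w j x) := by
  obtain ⟨Δ, h1, h2⟩ := exists_dividedDifference (koszulRoot B θ w) j
  let T := (Δ.restrictScalars A).lTensor (ExteriorAlgebra A M)
  refine ⟨contr _ (θ j) ∘ₗ T, fun i k hik x hx => contr_mem hik _ (lTensor_mem _ hx),
    fun x => ?_⟩
  have h3 : (LinearMap.mulLeft A (X j - C (koszulRoot B θ w j))).lTensor (ExteriorAlgebra A M)
      (T x) = x - evalTensor A M B θ w j x := by
    have : LinearMap.mulLeft A (X j - C (koszulRoot B θ w j)) ∘ₗ Δ.restrictScalars A =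
        LinearMap.id - (evalVar (koszulRoot B θ w) j).toLinearMap.restrictScalars A :=
      LinearMap.ext h1
    rw [← LinearMap.lTensor_comp_apply, this, LinearMap.lTensor_sub, LinearMap.lTensor_id]
    rfl
  have h4 : T (koszulDiff B e w x) = koszulDiff B e w (T x) +
      vec _ (e j) * evalTensor A M B θ w j x :=
    lTensor_koszulDiff e w _ _ j h2 x
  simp only [LinearMap.comp_apply, h4, map_add, contr_koszulDiff e θ w hθ, h3, contr_vec_mul,
    dual_smul e θ hθ, if_true]
  abel

omit hθ in
theorem koszulDiff_koszulDiff {i : ℤ} {y : ExtTensor A M (MvPolynomial (Fin r) B)}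
    (hy : y ∈ degPart A M (MvPolynomial (Fin r) B) i) :
    koszulDiff B e w (koszulDiff B e w y) = 0 := by
  obtain ⟨y, rfl⟩ := hy
  rw [koszulDiff, LinearMap.mulLeft_apply, LinearMap.mulLeft_apply,
    ← incl_wedgeTensor (rfl : i + 1 = i + 1), ← incl_wedgeTensor (rfl : i + 1 + 1 = i + 1 + 1),
    wedgeTensor_wedgeTensor_self, map_zero]

omit hθ in
/-- The elements that are fixed by the projection `eⱼ Cⱼ εⱼ`: those killed by `eⱼ ∧ ·` and independent
of `yⱼ`. The second condition is stated as invariance under the substitution of the root. -/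
def IsNormalized (j : Fin r) (x : ExtTensor A M (MvPolynomial (Fin r) B)) : Prop :=
  vec _ (e j) * x = 0 ∧ evalTensor A M B θ w j x = x

/-- An element `x` whose boundary is normalized can be made normalized, without a change of its
boundary, by subtracting a boundary and a cocycle `v`; if `x` is a cocycle, then `v = 0`. -/
theorem exists_normalized (s : Finset (Fin r)) {i k : ℤ} (hik : i + 1 = k)
    {x : ExtTensor A M (MvPolynomial (Fin r) B)}
    (hx : x ∈ degPart A M (MvPolynomial (Fin r) B) k)
    (hd : ∀ j, IsNormalized e θ w j (koszulDiff B e w x)) :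
    ∃ y ∈ degPart A M (MvPolynomial (Fin r) B) i,
      ∃ v ∈ degPart A M (MvPolynomial (Fin r) B) k,
        koszulDiff B e w v = 0 ∧ (koszulDiff B e w x = 0 → v = 0) ∧
          ∀ j ∈ s, IsNormalized e θ w j (x - koszulDiff B e w y - v) := by
  induction s using Finset.induction_on with
  | empty => exact ⟨0, Submodule.zero_mem _, 0, Submodule.zero_mem _, by simp⟩
  | insert j s hj ih =>
    obtain ⟨y, hy, v, hv, hdv, hv0, H⟩ := ih
    obtain ⟨h, hdeg, hh⟩ := exists_homotopy (B := B) e θ w hθ j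
    set z := x - koszulDiff B e w y - v with hz
    have hzd : koszulDiff B e w z = koszulDiff B e w x := by
      rw [hz, map_sub, map_sub, koszulDiff_koszulDiff e w hy, hdv, sub_zero, sub_zero]
    have hzm : z ∈ degPart A M (MvPolynomial (Fin r) B) k :=
      Submodule.sub_mem _ (Submodule.sub_mem _ hx (ιTensor_mul_mem hik _ hy)) hv
    have hxm := ιTensor_mul_mem (rfl : k + 1 = k + 1) (koszulVec B e w) hx
    have h2 : x - koszulDiff B e w (y + h z) - (v + h (koszulDiff B e w x)) =
        vec _ (e j) * contr _ (θ j) (evalTensor A M B θ w j z) := by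
      have h1 := hh z
      rw [hzd] at h1
      rw [map_add, ← sub_sub_self z (vec _ (e j) * _), ← h1, hz]
      abel
    refine ⟨y + h z, Submodule.add_mem _ hy (hdeg _ _ hik z hzm),
      v + h (koszulDiff B e w x), Submodule.add_mem _ hv (hdeg _ _ rfl _ hxm), ?_, ?_, ?_⟩
    · -- the projection fixes the normalized element `d x`, so `d (h (d x)) = 0`
      have h3 := hh (koszulDiff B e w x)
      have h4 := contr_vec_mul (θ j) (e j) (koszulDiff B e w x)
      rw [(hd j).1, map_zero, dual_smul e θ hθ, if_pos rfl, eq_comm] at h4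
      rw [koszulDiff_koszulDiff e w hx, map_zero, add_zero, (hd j).2, h4] at h3
      rw [map_add, hdv, h3, add_zero]
    · intro h0
      rw [hv0 h0, h0, map_zero, add_zero]
    rw [h2]
    intro i hi
    rcases Finset.mem_insert.1 hi with rfl | hi'
    · refine ⟨vec_mul_vec_self_mul _ _, ?_⟩
      rw [polyMap_vec_mul_contr, evalTensor_evalTensor]
    · obtain ⟨h3, h4⟩ := H i hi'
      have hij : i ≠ j := fun h => hj (h ▸ hi')
      constructor
      · have h5 := contr_vec_mul (θ j) (e i) (evalTensor A M B θ w j z)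
        have h6 : evalTensor A M B θ w j (vec _ (e i) * z) =
            vec _ (e i) * evalTensor A M B θ w j z := lTensor_vec_mul _ _ _
        rw [← h6, h3, map_zero, map_zero, dual_smul e θ hθ, if_neg hij, zero_sub,
          eq_comm, neg_eq_zero] at h5
        rw [vec_mul_vec_mul, h5, mul_zero, neg_zero]
      · rw [polyMap_vec_mul_contr, evalTensor_comm, h4]

omit hθ in
/-- An element invariant under each substitution is invariant under all of them at once. -/
theorem polyMap_aeval_eq_self {x : ExtTensor A M (MvPolynomial (Fin r) B)}
    (hx : ∀ j, evalTensor A M B θ w j x = x) :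
    polyMap A M (aeval fun i => C (koszulRoot B θ w i)) x = x := by
  classical
  have key : ∀ s : Finset (Fin r),
      polyMap A M (aeval fun i => if i ∈ s then C (koszulRoot B θ w i) else X i) x = x := by
    intro s
    induction s using Finset.induction_on with
    | empty =>
      have : (aeval fun i => if i ∈ (∅ : Finset (Fin r)) then C (koszulRoot B θ w i) else X i :
          MvPolynomial (Fin r) B →ₐ[B] MvPolynomial (Fin r) B) = AlgHom.id B _ := by
        ext i
        simp
      rw [this]
      exact LinearMap.lTensor_id_apply _ _ x
    | insert j s hj ih =>
      have : (aeval fun i => if i ∈ insert j s then C (koszulRoot B θ w i) else X i :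
          MvPolynomial (Fin r) B →ₐ[B] MvPolynomial (Fin r) B) =
          (evalVar (koszulRoot B θ w) j).comp
            (aeval fun i => if i ∈ s then C (koszulRoot B θ w i) else X i) := by
        refine MvPolynomial.algHom_ext fun i => ?_
        by_cases h1 : i ∈ s
        · simp [h1, ← MvPolynomial.algebraMap_eq]
        · by_cases h2 : i = j <;> simp [h1, h2, hj, evalVar_X]
      rw [this, polyMap_comp_apply, ih, hx]
  simpa using key Finset.univ

omit hθ in
variable (A M r B) in
/-- The map `⋀ M ⊗ B → ⋀ M ⊗ B[y]` given by the constant polynomials. -/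
noncomputable def constTensor : ExtTensor A M B →ₗ[A] ExtTensor A M (MvPolynomial (Fin r) B) :=
  ((Algebra.linearMap B (MvPolynomial (Fin r) B)).restrictScalars A).lTensor (ExteriorAlgebra A M)

omit hθ in
theorem constTensor_mem {k : ℤ} {x : ExtTensor A M B} (hx : x ∈ degPart A M B k) :
    constTensor A M B r x ∈ degPart A M (MvPolynomial (Fin r) B) k :=
  lTensor_mem _ hx

omit hθ in
variable (A M B) in
/-- The map `⋀ M ⊗ B[y] → ⋀ M ⊗ B` given by a `B`-linear functional on `B[y]`. -/
noncomputable def coeffTensor (f : MvPolynomial (Fin r) B →ₗ[B] B) :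
    ExtTensor A M (MvPolynomial (Fin r) B) →ₗ[A] ExtTensor A M B :=
  (f.restrictScalars A).lTensor (ExteriorAlgebra A M)

omit hθ in
theorem coeffTensor_vec_mul (f : MvPolynomial (Fin r) B →ₗ[B] B) (m : M)
    (x : ExtTensor A M (MvPolynomial (Fin r) B)) :
    coeffTensor A M B f (vec _ m * x) = vec B m * coeffTensor A M B f x :=
  lTensor_vec_mul _ _ _

omit hθ in
theorem coeffTensor_mul_constTensor (f : MvPolynomial (Fin r) B →ₗ[B] B)
    (p : MvPolynomial (Fin r) B) (b : B) (h : f p = b) (x : ExtTensor A M B) :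
    coeffTensor A M B f ((LinearMap.mulLeft A p).lTensor (ExteriorAlgebra A M)
      (constTensor A M B r x)) = (LinearMap.mulLeft A b).lTensor (ExteriorAlgebra A M) x := by
  have h1 : f.restrictScalars A ∘ₗ LinearMap.mulLeft A p ∘ₗ
      (Algebra.linearMap B (MvPolynomial (Fin r) B)).restrictScalars A = LinearMap.mulLeft A b := by
    refine LinearMap.ext fun c => ?_
    change f (p * algebraMap B _ c) = b * c
    rw [mul_comm, ← Algebra.smul_def, map_smul, h, smul_eq_mul, mul_comm]
  rw [← h1, LinearMap.lTensor_comp, LinearMap.lTensor_comp]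
  rfl

omit hθ in
theorem coeffTensor_constTensor (f : MvPolynomial (Fin r) B →ₗ[B] B) (b : B) (h : f 1 = b)
    (x : ExtTensor A M B) : coeffTensor A M B f (constTensor A M B r x) =
      (LinearMap.mulLeft A b).lTensor (ExteriorAlgebra A M) x := by
  rw [← coeffTensor_mul_constTensor f 1 b h, LinearMap.mulLeft_one, LinearMap.lTensor_id]
  rfl

omit hθ in
theorem constTensor_injective : Function.Injective (constTensor A M B r) := by
  refine Function.LeftInverse.injective
    (g := coeffTensor A M B (aeval (0 : Fin r → B)).toLinearMap) fun x => ?_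
  rw [coeffTensor_constTensor _ 1 (map_one (aeval (0 : Fin r → B))), LinearMap.mulLeft_one, LinearMap.lTensor_id]
  rfl

omit hθ in
theorem constTensor_vec_mul (m : M) (x : ExtTensor A M B) :
    constTensor A M B r (vec B m * x) = vec _ m * constTensor A M B r x :=
  lTensor_vec_mul _ _ _

omit hθ in
theorem koszulDiff_constTensor {x : ExtTensor A M B} (hx : ∀ j, vec B (e j) * x = 0) :
    koszulDiff B e w (constTensor A M B r x) = constTensor A M B r (vec B w * x) := by
  rw [koszulDiff_apply, constTensor_vec_mul]
  refine add_eq_left.2 (Finset.sum_eq_zero fun i _ => ?_)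
  rw [← lTensor_vec_mul, ← constTensor_vec_mul, hx, map_zero, map_zero]

omit hθ in
/-- If `x` and its boundary are both constant in `y`, then every `eⱼ ∧ x` vanishes: it is the
coefficient of `yⱼ` in the boundary. -/
theorem vec_mul_eq_zero_of_koszulDiff_constTensor {x z : ExtTensor A M B}
    (h : koszulDiff B e w (constTensor A M B r x) = constTensor A M B r z) (j : Fin r) :
    vec B (e j) * x = 0 := by
  classical
  let f := lcoeff B (Finsupp.single j 1)
  have h1 : f 1 = 0 := by
    rw [lcoeff_apply, MvPolynomial.coeff_one, if_neg]
    exact fun h => by simpa using DFunLike.congr_fun h j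
  have h2 : ∀ i, f (X i) = if i = j then 1 else 0 := fun i => by
    simp [f, MvPolynomial.coeff_X, Finsupp.single_left_inj]
  have hm0 : (LinearMap.mulLeft A (0 : B)).lTensor (ExteriorAlgebra A M) = 0 := by
    rw [LinearMap.mulLeft_zero_eq_zero, LinearMap.lTensor_zero]
  have h3 := congrArg (coeffTensor A M B f) h
  rw [koszulDiff_apply, map_add, map_sum, coeffTensor_constTensor f 0 h1, coeffTensor_vec_mul,
    coeffTensor_constTensor f 0 h1, hm0] at h3
  simp only [coeffTensor_vec_mul, coeffTensor_mul_constTensor f (X _) _ (h2 _),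
    LinearMap.zero_apply, mul_zero, zero_add] at h3
  rw [Finset.sum_eq_single j] at h3
  · rw [if_pos rfl, LinearMap.mulLeft_one, LinearMap.lTensor_id] at h3
    exact h3
  · intro i _ hij
    rw [if_neg hij, hm0, LinearMap.zero_apply, mul_zero]
  · simp

omit hθ in
theorem isNormalized_constTensor {x : ExtTensor A M B} (hx : ∀ j, vec B (e j) * x = 0)
    (j : Fin r) : IsNormalized e θ w j (constTensor A M B r x) := by
  refine ⟨by rw [← constTensor_vec_mul, hx, map_zero], ?_⟩
  have h1 : (evalVar (koszulRoot B θ w) j).toLinearMap.restrictScalars A ∘ₗ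
      (Algebra.linearMap B (MvPolynomial (Fin r) B)).restrictScalars A =
        (Algebra.linearMap B (MvPolynomial (Fin r) B)).restrictScalars A :=
    LinearMap.ext fun b => (evalVar (koszulRoot B θ w) j).commutes b
  rw [constTensor, evalTensor, polyMap, ← LinearMap.lTensor_comp_apply, h1]

omit hθ in
theorem exists_eq_constTensor {k : ℤ} {x : ExtTensor A M (MvPolynomial (Fin r) B)}
    (hx : x ∈ degPart A M (MvPolynomial (Fin r) B) k) (h : ∀ j, IsNormalized e θ w j x) :
    ∃ y ∈ degPart A M B k, (∀ j, vec B (e j) * y = 0) ∧ constTensor A M B r y = x := by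
  let f : MvPolynomial (Fin r) B →ₗ[B] B := (aeval (koszulRoot B θ w)).toLinearMap
  refine ⟨coeffTensor A M B f x, lTensor_mem _ hx, fun j => ?_, ?_⟩
  · rw [← coeffTensor_vec_mul, (h j).1, map_zero]
  · have h1 : (Algebra.linearMap B (MvPolynomial (Fin r) B)).restrictScalars A ∘ₗ
        f.restrictScalars A =
        (aeval fun i => C (koszulRoot B θ w i) :
          MvPolynomial (Fin r) B →ₐ[B] MvPolynomial (Fin r) B).toLinearMap.restrictScalars A := by
      have h2 : (Algebra.ofId B (MvPolynomial (Fin r) B)).comp (aeval (koszulRoot B θ w)) =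
          aeval fun i => C (koszulRoot B θ w i) := by
        refine MvPolynomial.algHom_ext fun i => ?_
        simp [Algebra.ofId_apply, MvPolynomial.algebraMap_eq]
      exact LinearMap.ext fun p => DFunLike.congr_fun h2 p
    have h3 := polyMap_aeval_eq_self θ w fun j => (h j).2
    rw [polyMap, ← h1, LinearMap.lTensor_comp_apply] at h3
    exact h3

end Homotopy

/-! ### Forms on `B` as multiples of `e₁ ∧ ⋯ ∧ eᵣ` -/

section Top

variable {A : Type u} [CommRing A] {M : Type u} [AddCommGroup M] [Module A M]
  {B : Type u} [CommRing B] [Algebra A B] {r : ℕ} (e : Fin r → M)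

variable (B) in
/-- The product of the vectors `eⱼ`, for `j` in a list. -/
noncomputable def vecProd (l : List (Fin r)) : ExtTensor A M B :=
  (l.map fun j => (vec B (e j) : ExtTensor A M B)).prod

@[simp]
theorem vecProd_nil : vecProd B e [] = (1 : ExtTensor A M B) := rfl

theorem vecProd_cons (j : Fin r) (l : List (Fin r)) :
    vecProd B e (j :: l) = (vec B (e j) * vecProd B e l : ExtTensor A M B) := by
  simp [vecProd]

theorem mul_vec_mem {i k : ℤ} (h : i + 1 = k) (m : M) {z : ExtTensor A M B}
    (hz : z ∈ degPart A M B i) : z * vec B m ∈ degPart A M B k := by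
  obtain ⟨c, -, hc⟩ := exists_mul_vec_eq_smul (A := A) (M := M) (S := B) i
  rw [hc z hz m]
  exact Submodule.smul_mem _ _ (ιTensor_mul_mem h _ hz)

theorem mul_vecProd_mem (l : List (Fin r)) {i k : ℤ} (h : i + l.length = k) {z : ExtTensor A M B}
    (hz : z ∈ degPart A M B i) : z * vecProd B e l ∈ degPart A M B k := by
  induction l generalizing i z with
  | nil =>
    obtain rfl : i = k := by simpa using h
    simpa using hz
  | cons j l ih =>
    rw [vecProd_cons, ← mul_assoc]
    refine ih (i := i + 1) ?_ (mul_vec_mem rfl _ hz)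
    rw [← h, List.length_cons]
    push_cast
    ring

theorem vec_mul_mul_vecProd_eq_zero {j : Fin r} {l : List (Fin r)} (hj : j ∈ l) {i : ℤ}
    {z : ExtTensor A M B} (hz : z ∈ degPart A M B i) :
    vec B (e j) * (z * vecProd B e l) = 0 := by
  induction l generalizing i z with
  | nil => simp at hj
  | cons a l ih =>
    rw [vecProd_cons, ← mul_assoc z]
    rcases List.mem_cons.1 hj with rfl | hj
    · obtain ⟨c, -, hc⟩ := exists_mul_vec_eq_smul (A := A) (M := M) (S := B) i
      rw [hc z hz, smul_mul_assoc, mul_smul_comm, mul_assoc, vec_mul_vec_self_mul, smul_zero]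
    · exact ih hj (mul_vec_mem rfl _ hz)

theorem exists_mul_vecProd_eq_smul (l : List (Fin r)) (i : ℤ) :
    ∃ c : A, c * c = 1 ∧ ∀ z ∈ degPart A M B i,
      z * vecProd B e l = c • (vecProd B e l * z) := by
  obtain ⟨c, hc, h⟩ := exists_mul_vec_eq_smul (A := A) (M := M) (S := B) i
  induction l with
  | nil => exact ⟨1, one_mul _, by simp⟩
  | cons a l ih =>
    obtain ⟨c', hc', h'⟩ := ih
    refine ⟨c * c', by rw [mul_mul_mul_comm, hc, hc', one_mul], fun z hz => ?_⟩
    rw [vecProd_cons, ← mul_assoc, h z hz, smul_mul_assoc, mul_assoc, h' z hz, mul_smul_comm,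
      smul_smul, mul_assoc]

variable (θ : Fin r → Module.Dual A M)
  (hθ : ∀ i j, algebraMap A B (θ j (e i)) = if i = j then 1 else 0)

include hθ

theorem contr_vecProd_mul {j : Fin r} {l : List (Fin r)} (hj : j ∉ l) {z : ExtTensor A M B}
    (hz : contr B (θ j) z = 0) : contr B (θ j) (vecProd B e l * z) = 0 := by
  induction l with
  | nil => simpa using hz
  | cons a l ih =>
    rw [List.mem_cons, not_or] at hj
    rw [vecProd_cons, mul_assoc, contr_vec_mul, dual_smul e θ hθ, if_neg (Ne.symm hj.1),
      ih hj.2, mul_zero, sub_zero]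

/-- Contracting with the `θⱼ` cancels the product of the `eⱼ`. -/
theorem eq_zero_of_vecProd_mul_eq_zero {l : List (Fin r)} (hl : l.Nodup) {z : ExtTensor A M B}
    (hz : ∀ j, contr B (θ j) z = 0) (h : vecProd B e l * z = 0) : z = 0 := by
  induction l with
  | nil => simpa using h
  | cons a l ih =>
    rw [List.nodup_cons] at hl
    refine ih hl.2 ?_
    have h1 := contr_vec_mul (θ a) (e a) (vecProd B e l * z)
    rw [← mul_assoc, ← vecProd_cons, h, map_zero, contr_vecProd_mul e θ hθ hl.1 (hz a),
      dual_smul e θ hθ, if_pos rfl, mul_zero, sub_zero] at h1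
    exact h1.symm

/-- An element killed by the `eⱼ` is divisible by their product: it is `x = eⱼ ∧ Cⱼ x`. -/
theorem exists_eq_vecProd_mul {l : List (Fin r)} (hl : l.Nodup) {i k : ℤ} (h : i + l.length = k)
    {x : ExtTensor A M B} (hx : x ∈ degPart A M B k) (h0 : ∀ j ∈ l, vec B (e j) * x = 0) :
    ∃ y ∈ degPart A M B i, x = vecProd B e l * y := by
  induction l generalizing k x with
  | nil =>
    obtain rfl : i = k := by simpa using h
    exact ⟨x, hx, by simp⟩
  | cons a l ih =>
    rw [List.nodup_cons] at hl
    have h1 : vec B (e a) * contr B (θ a) x = x := by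
      have h2 := contr_vec_mul (θ a) (e a) x
      rw [h0 a List.mem_cons_self, map_zero, dual_smul e θ hθ, if_pos rfl] at h2
      exact (sub_eq_zero.1 h2.symm).symm
    obtain ⟨y, hy, hxy⟩ := ih hl.2 (k := i + l.length) rfl
      (contr_mem (by rw [← h, List.length_cons]; push_cast; ring) (θ a) hx) (fun j hj => by
        have h2 := contr_vec_mul (θ a) (e j) x
        rw [h0 j (List.mem_cons_of_mem _ hj), map_zero, dual_smul e θ hθ,
          if_neg (fun h3 : j = a => hl.1 (h3 ▸ hj)), zero_sub, eq_comm, neg_eq_zero] at h2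
        exact h2)
    exact ⟨y, hy, by rw [vecProd_cons, mul_assoc, ← hxy, h1]⟩

end Top

section Section

variable {A : Type u} [CommRing A] {M : Type u} [AddCommGroup M] [Module A M]
  {B : Type u} [CommRing B] [Algebra A B] {N : Type u} [AddCommGroup N] [Module B N]
  (σ : N →ₗ[B] B ⊗[A] M)

theorem baseChange_ι_mul_self (t : B ⊗[A] M) :
    (ExteriorAlgebra.ι A (M := M)).baseChange B t * (ExteriorAlgebra.ι A (M := M)).baseChange B t =
      0 := by
  have hcomm : ∀ t t' : B ⊗[A] M,
      (ExteriorAlgebra.ι A (M := M)).baseChange B t *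
        (ExteriorAlgebra.ι A (M := M)).baseChange B t' +
      (ExteriorAlgebra.ι A (M := M)).baseChange B t' *
        (ExteriorAlgebra.ι A (M := M)).baseChange B t = 0 := by
    intro t t'
    induction t with
    | zero => simp
    | add t₁ t₂ h₁ h₂ =>
      simp only [map_add, add_mul, mul_add]
      rw [add_add_add_comm, h₁, h₂, add_zero]
    | tmul b m =>
      induction t' with
      | zero => simp
      | add t₁ t₂ h₁ h₂ =>
        simp only [map_add, add_mul, mul_add]
        rw [add_add_add_comm, h₁, h₂, add_zero]
      | tmul b' m' =>
        simp only [LinearMap.baseChange_tmul, Algebra.TensorProduct.tmul_mul_tmul]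
        rw [mul_comm b' b, ← TensorProduct.tmul_add, ExteriorAlgebra.ι_add_mul_swap,
          TensorProduct.tmul_zero]
  induction t with
  | zero => simp
  | add t₁ t₂ h₁ h₂ =>
    have := hcomm t₁ t₂
    simp only [map_add, add_mul, mul_add, h₁, h₂, zero_add, add_zero]
    rwa [add_comm]
  | tmul b m => simp [Algebra.TensorProduct.tmul_mul_tmul]

theorem one_mem_extPow : (1 : ExteriorAlgebra A M) ∈ extPow A M (Int.ofNat 0) := by
  exact Submodule.one_le.1 (pow_zero (LinearMap.range (ExteriorAlgebra.ι A (M := M)))).ge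

/-- The ring homomorphism `⋀_B N → ⋀_A M ⊗ B` that extends a `B`-linear map `σ : N → B ⊗ M`, with the
two tensor factors interchanged. -/
noncomputable def extLift : ExteriorAlgebra B N →+* ExtTensor A M B :=
  (Algebra.TensorProduct.comm A B (ExteriorAlgebra A M)).toRingEquiv.toRingHom.comp
    (ExteriorAlgebra.lift B ⟨(ExteriorAlgebra.ι A).baseChange B ∘ₗ σ,
      fun n => baseChange_ι_mul_self (σ n)⟩).toRingHom

theorem extLift_algebraMap (b : B) :
    extLift σ (algebraMap B (ExteriorAlgebra B N) b) = 1 ⊗ₜ[A] b := by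
  simp [extLift]

theorem extLift_ι (n : N) :
    extLift σ (ExteriorAlgebra.ι B n) = ιTensor B (TensorProduct.comm A B M (σ n)) := by
  simp only [extLift, AlgHom.toRingHom_eq_coe, RingHom.comp_apply, RingHom.coe_coe,
    ExteriorAlgebra.lift_ι_apply, LinearMap.comp_apply]
  induction σ n with
  | zero => simp
  | add t₁ t₂ h₁ h₂ => simp only [map_add, h₁, h₂]
  | tmul b m => simp

theorem extLift_smul (b : B) (x : ExteriorAlgebra B N) :
    extLift σ (b • x) = ((1 : ExteriorAlgebra A M) ⊗ₜ[A] b) * extLift σ x := by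
  rw [Algebra.smul_def, map_mul, extLift_algebraMap]

theorem extLift_mem {i : ℤ} {x : ExteriorAlgebra B N} (hx : x ∈ extPow B N i) :
    extLift σ x ∈ degPart A M B i := by
  match i with
  | Int.negSucc k =>
    have h0 : x = 0 := hx
    rw [h0, map_zero]
    exact Submodule.zero_mem _
  | Int.ofNat k =>
    change x ∈ ⋀[B]^k N at hx
    induction hx using Submodule.pow_induction_on_left' with
    | algebraMap b =>
      rw [extLift_algebraMap]
      exact tmul_mem_degPart one_mem_extPow b
    | add x y i hx hy h₁ h₂ =>
      rw [map_add]
      exact Submodule.add_mem _ h₁ h₂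
    | mem_mul n hn i x hx ih =>
      obtain ⟨n, rfl⟩ := hn
      rw [map_mul, extLift_ι]
      exact ιTensor_mul_mem (i := Int.ofNat i) (j := Int.ofNat (i + 1)) rfl _ ih

variable {r : ℕ} (e : Fin r → M) (θ : Fin r → Module.Dual A M)
  [Module A N] (ρ : M →ₗ[A] N) (hρ : Function.Surjective ρ)
  (hσ : ∀ m, σ (ρ m) = 1 ⊗ₜ m - ∑ j, θ j m • (1 ⊗ₜ e j))

include hσ

theorem extLift_ι_apply (m : M) : extLift σ (ExteriorAlgebra.ι B (ρ m)) =
    vec B m - ∑ j, θ j m • vec B (e j) := by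
  rw [extLift_ι, hσ]
  simp only [map_sub, map_sum, map_smul, TensorProduct.comm_tmul]

/-- Against the product of all `eⱼ`, the vectors `σ(ρ m)` and `m` agree, as they differ by a
combination of the `eⱼ`. -/
theorem extLift_ι_mul_mul_vecProd {l : List (Fin r)} (hl : ∀ j, j ∈ l) {i : ℤ}
    {x : ExteriorAlgebra B N} (hx : x ∈ extPow B N i) (m : M) :
    extLift σ (ExteriorAlgebra.ι B (ρ m) * x) * vecProd B e l =
      vec B m * (extLift σ x * vecProd B e l) := by
  rw [map_mul, extLift_ι_apply σ e θ ρ hσ, mul_assoc, sub_mul, Finset.sum_mul]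
  simp only [smul_mul_assoc, vec_mul_mul_vecProd_eq_zero e (hl _) (extLift_mem σ hx), smul_zero,
    Finset.sum_const_zero, sub_zero]

theorem exists_mul_vecProd_eq_extLift {l : List (Fin r)} (hl : ∀ j, j ∈ l) {i : ℤ}
    {y : ExtTensor A M B} (hy : y ∈ degPart A M B i) :
    ∃ x ∈ extPow B N i, y * vecProd B e l = extLift σ x * vecProd B e l := by
  have key : ∀ y ∈ extPow A M i, ∃ x ∈ extPow B N i,
      (y ⊗ₜ[A] (1 : B)) * vecProd B e l = extLift σ x * vecProd B e l := by
    clear hy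
    intro y hy
    match i with
    | Int.negSucc k =>
      have h0 : y = 0 := hy
      exact ⟨0, Submodule.zero_mem _, by simp [h0]⟩
    | Int.ofNat k =>
      change y ∈ ⋀[A]^k M at hy
      induction hy using Submodule.pow_induction_on_left' with
      | algebraMap a =>
        refine ⟨algebraMap B _ (algebraMap A B a),
          SetLike.algebraMap_mem_graded (fun k : ℕ => ⋀[B]^k N) _, ?_⟩
        rw [extLift_algebraMap, Algebra.algebraMap_eq_smul_one, TensorProduct.smul_tmul,
          Algebra.algebraMap_eq_smul_one]
      | add y z i hy hz h₁ h₂ =>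
        obtain ⟨x₁, hx₁, h₁⟩ := h₁
        obtain ⟨x₂, hx₂, h₂⟩ := h₂
        exact ⟨x₁ + x₂, Submodule.add_mem _ hx₁ hx₂, by
          rw [TensorProduct.add_tmul, add_mul, h₁, h₂, map_add, add_mul]⟩
      | mem_mul m hm i y hy ih =>
        obtain ⟨m, rfl⟩ := hm
        obtain ⟨x, hx, h⟩ := ih
        refine ⟨ExteriorAlgebra.ι B (ρ m) * x,
          ι_mul_mem_extPow (i := Int.ofNat i) (j := Int.ofNat (i + 1)) rfl _ hx, ?_⟩
        have h1 : ((ExteriorAlgebra.ι A m * y) ⊗ₜ[A] (1 : B) : ExtTensor A M B) =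
            vec B m * (y ⊗ₜ[A] (1 : B)) := by simp
        rw [h1, mul_assoc, h, extLift_ι_mul_mul_vecProd σ e θ ρ hσ hl (i := Int.ofNat i) hx]
  obtain ⟨y, rfl⟩ := hy
  induction y with
  | zero => exact ⟨0, Submodule.zero_mem _, by simp⟩
  | add y z h₁ h₂ =>
    obtain ⟨x₁, hx₁, h₁⟩ := h₁
    obtain ⟨x₂, hx₂, h₂⟩ := h₂
    exact ⟨x₁ + x₂, Submodule.add_mem _ hx₁ hx₂, by
      rw [map_add, add_mul, h₁, h₂, map_add, add_mul]⟩
  | tmul y b =>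
    obtain ⟨x, hx, h⟩ := key y y.2
    refine ⟨b • x, Submodule.smul_mem _ _ hx, ?_⟩
    rw [extLift_smul, mul_assoc, ← h, ← mul_assoc]
    simp

include hρ

theorem contr_extLift (hθ : ∀ i j, algebraMap A B (θ j (e i)) = if i = j then 1 else 0)
    (j : Fin r) (x : ExteriorAlgebra B N) : contr B (θ j) (extLift σ x) = 0 := by
  induction x using CliffordAlgebra.left_induction with
  | algebraMap b =>
    have h : extLift σ (algebraMap B (CliffordAlgebra 0) b) = 1 ⊗ₜ[A] b := extLift_algebraMap σ b
    rw [h, contr_tmul]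
    have h1 := CliffordAlgebra.contractLeft_one (Q := (0 : QuadraticForm A M)) (θ j)
    exact (congrArg (fun z => z ⊗ₜ[A] b) h1).trans (TensorProduct.zero_tmul _ _)
  | add x y hx hy => rw [map_add, map_add, hx, hy, add_zero]
  | ι_mul x n hx =>
    obtain ⟨m, rfl⟩ := hρ n
    have h : extLift σ (CliffordAlgebra.ι 0 (ρ m)) = vec B m - ∑ j, θ j m • vec B (e j) :=
      extLift_ι_apply σ e θ ρ hσ m
    rw [map_mul, h, sub_mul, Finset.sum_mul, map_sub, map_sum]
    simp only [smul_mul_assoc, map_smul, contr_vec_mul, hx, mul_zero, sub_zero,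
      dual_smul e θ hθ, smul_ite, smul_zero, Finset.sum_ite_eq', Finset.mem_univ, if_true, sub_self]

theorem extLift_injective [IsScalarTower A B N] (hρe : ∀ j, ρ (e j) = 0) : Function.Injective (extLift σ) := by
  -- the algebra homomorphism induced by `ρ` is a left inverse
  let π : ExtTensor A M B →ₐ[A] ExteriorAlgebra B N :=
    Algebra.TensorProduct.lift
      (ExteriorAlgebra.lift A ⟨(ExteriorAlgebra.ι B).restrictScalars A ∘ₗ ρ, fun m => by simp⟩)
      (IsScalarTower.toAlgHom A B (ExteriorAlgebra B N)) fun _ _ => (Algebra.commutes _ _).symm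
  have hπ : ∀ m, π (vec B m) = ExteriorAlgebra.ι B (ρ m) := fun m =>
    (Algebra.TensorProduct.lift_tmul _ _ _ _ _).trans (by simp)
  refine Function.LeftInverse.injective (g := π) fun x => ?_
  induction x using CliffordAlgebra.left_induction with
  | algebraMap b =>
    have h : extLift σ (algebraMap B (CliffordAlgebra 0) b) = 1 ⊗ₜ[A] b := extLift_algebraMap σ b
    rw [h]
    refine (Algebra.TensorProduct.lift_tmul _ _ _ _ _).trans ?_
    rw [map_one, one_mul]
    rfl
  | add x y hx hy => rw [map_add, map_add, hx, hy]
  | ι_mul x n hx =>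
    obtain ⟨m, rfl⟩ := hρ n
    have h : extLift σ (CliffordAlgebra.ι 0 (ρ m)) = vec B m - ∑ j, θ j m • vec B (e j) :=
      extLift_ι_apply σ e θ ρ hσ m
    rw [map_mul, h, map_mul, hx, map_sub, map_sum]
    simp only [map_smul, hπ, hρe, map_zero, smul_zero, Finset.sum_const_zero, sub_zero]

theorem eq_zero_of_extLift_mul_vecProd_eq_zero [IsScalarTower A B N]
    (hθ : ∀ i j, algebraMap A B (θ j (e i)) = if i = j then 1 else 0)
    (hρe : ∀ j, ρ (e j) = 0) {l : List (Fin r)} (hl : l.Nodup) {i : ℤ} {x : ExteriorAlgebra B N}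
    (hx : x ∈ extPow B N i) (h : extLift σ x * vecProd B e l = 0) : x = 0 := by
  obtain ⟨c, hc, h'⟩ := exists_mul_vecProd_eq_smul (A := A) (B := B) e l i
  rw [h' _ (extLift_mem σ hx)] at h
  have h1 := congrArg (c • ·) h
  simp only [smul_smul, hc, one_smul, smul_zero] at h1
  apply extLift_injective σ e θ ρ hρ hσ hρe
  rw [map_zero]
  exact eq_zero_of_vecProd_mul_eq_zero e θ hθ hl (fun j => contr_extLift σ e θ ρ hρ hσ hθ j x) h1

omit hρ in
theorem exists_extLift_mul_vecProd_eq
    (hθ : ∀ i j, algebraMap A B (θ j (e i)) = if i = j then 1 else 0)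
    {l : List (Fin r)} (hl : l.Nodup) (hl' : ∀ j, j ∈ l) {i k : ℤ} (hik : i + l.length = k)
    {x : ExtTensor A M B} (hx : x ∈ degPart A M B k) (h0 : ∀ j, vec B (e j) * x = 0) :
    ∃ y ∈ extPow B N i, extLift σ y * vecProd B e l = x := by
  obtain ⟨y, hy, rfl⟩ := exists_eq_vecProd_mul e θ hθ hl hik hx fun j _ => h0 j
  obtain ⟨c, hc, h'⟩ := exists_mul_vecProd_eq_smul (A := A) (B := B) e l i
  obtain ⟨z, hz, h⟩ := exists_mul_vecProd_eq_extLift σ e θ ρ hσ hl' (Submodule.smul_mem _ c hy)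
  refine ⟨z, hz, ?_⟩
  rw [← h, smul_mul_assoc, h' y hy, smul_smul, hc, one_smul]

end Section

/-! ### Complexes -/

section Homology

open CategoryTheory HomologicalComplex

theorem shortComplex_quasiIso_of_elementwise {A : Type u} [CommRing A]
    {S T : ShortComplex (ModuleCat A)} (ψ : S ⟶ T)
    (hsurj : ∀ x : T.X₂, T.g x = 0 → ∃ c : S.X₂, S.g c = 0 ∧ ∃ y : T.X₁, x = ψ.τ₂ c + T.f y)
    (hinj : ∀ (c : S.X₂) (y : T.X₁), S.g c = 0 → ψ.τ₂ c = T.f y → ∃ b : S.X₁, c = S.f b) :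
    ShortComplex.QuasiIso ψ := by
  rw [ShortComplex.quasiIso_iff]
  have hex : ∀ S : ShortComplex (ModuleCat A),
      Function.Exact S.toCycles S.homologyπ := fun S =>
    (ShortComplex.ShortExact.moduleCat_exact_iff_function_exact _).1
      (ShortComplex.exact_of_g_is_cokernel (ShortComplex.mk _ _ S.toCycles_comp_homologyπ)
        S.homologyIsCokernel)
  have hπ : ∀ S : ShortComplex (ModuleCat A), Function.Surjective S.homologyπ := fun S =>
    (ModuleCat.epi_iff_surjective _).1 inferInstance
  have hi : ∀ S : ShortComplex (ModuleCat A), Function.Injective S.iCycles := fun S =>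
    (ModuleCat.mono_iff_injective _).1 inferInstance
  have htoC : ∀ (S : ShortComplex (ModuleCat A)) (x : S.X₁),
      S.iCycles (S.toCycles x) = S.f x := fun S x =>
    ConcreteCategory.congr_hom S.toCycles_i x
  have hgi : ∀ (S : ShortComplex (ModuleCat A)) (z : S.cycles), S.g (S.iCycles z) = 0 :=
    fun S z => ConcreteCategory.congr_hom S.iCycles_g z
  have hcyc : ∀ z, T.iCycles (ShortComplex.cyclesMap ψ z) = ψ.τ₂ (S.iCycles z) := fun z =>
    ConcreteCategory.congr_hom (ShortComplex.cyclesMap_i ψ) z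
  have hhom : ∀ z, ShortComplex.homologyMap ψ (S.homologyπ z) =
      T.homologyπ (ShortComplex.cyclesMap ψ z) := fun z =>
    ConcreteCategory.congr_hom (ShortComplex.homologyπ_naturality ψ) z
  rw [ConcreteCategory.isIso_iff_bijective]
  constructor
  · refine (injective_iff_map_eq_zero (ShortComplex.homologyMap ψ).hom).2 fun h hh => ?_
    obtain ⟨z, rfl⟩ := hπ _ h
    obtain ⟨y, hy⟩ := (hex _ _).1 ((hhom z).symm.trans hh)
    have h2 := congrArg T.iCycles hy
    rw [htoC, hcyc] at h2
    obtain ⟨b, hb⟩ := hinj _ y (hgi _ z) h2.symm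
    refine (hex _ _).2 ⟨b, hi _ ?_⟩
    rw [htoC, hb]
  · intro h
    obtain ⟨z, rfl⟩ := hπ _ h
    obtain ⟨c, hc, y, hxy⟩ := hsurj _ (hgi _ z)
    obtain ⟨z', rfl⟩ : ∃ z, S.iCycles z = c :=
      ((ShortComplex.ShortExact.moduleCat_exact_iff_function_exact _).1
        (ShortComplex.exact_of_f_is_kernel (ShortComplex.mk _ _ S.iCycles_g) S.cyclesIsKernel)
          c).1 hc
    refine ⟨S.homologyπ z', ?_⟩
    have h3 : z = ShortComplex.cyclesMap ψ z' + T.toCycles y := by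
      apply hi
      rw [map_add, hcyc, htoC, hxy]
    have h4 : T.homologyπ (T.toCycles y) = 0 := (hex T _).2 ⟨y, rfl⟩
    rw [hhom, h3, map_add, h4, add_zero]

/-- An elementwise criterion for a morphism of complexes of modules to be a quasi-isomorphism. -/
theorem quasiIso_of_elementwise {A : Type u} [CommRing A]
    {C D : CochainComplex (ModuleCat A) ℤ} (φ : C ⟶ D)
    (hsurj : ∀ (i j k : ℤ), i + 1 = j → j + 1 = k → ∀ x : D.X j, (D.d j k).hom x = 0 →
      ∃ c : C.X j, (C.d j k).hom c = 0 ∧ ∃ y : D.X i, x = (φ.f j).hom c + (D.d i j).hom y)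
    (hinj : ∀ (i j k : ℤ), i + 1 = j → j + 1 = k → ∀ (c : C.X j) (y : D.X i),
      (C.d j k).hom c = 0 → (φ.f j).hom c = (D.d i j).hom y → ∃ b : C.X i, c = (C.d i j).hom b) : QuasiIso φ := by
  rw [quasiIso_iff]
  intro i
  rw [quasiIsoAt_iff' φ (i - 1) i (i + 1) (by simp) (by simp)]
  exact shortComplex_quasiIso_of_elementwise _ (hsurj _ _ _ (by simp) rfl)
    (hinj _ _ _ (by simp) rfl)

theorem nonempty_homology_shiftDown_iso {A : Type u} [CommRing A]
    (C : CochainComplex (ModuleCat A) ℤ) (r i : ℤ) :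
    Nonempty (C.homology (i - r) ≅ (shiftDown C r).homology i) :=
  ⟨ShortComplex.homologyMapIso (C.isoSc' (i - 1 - r) (i - r) (i + 1 - r)
      (by simp; ring) (by simp; ring)) ≪≫
    (ShortComplex.homologyMapIso ((shiftDown C r).isoSc' (i - 1) i (i + 1)
      (by simp) (by simp))).symm⟩

end Homology

section Assembly

open CategoryTheory

variable (K : Type v) {A : Type u} [Field K] [CommRing A] [Algebra K A] {r : ℕ} (f : A)
  (g : Fin r → A)

open scoped Pointwise in
theorem mem_polyFiltration_zero_iff (p : QuotPoly g) :
    p ∈ polyFiltration g 0 ↔ ∃ b, algebraMap (Quot g) (QuotPoly g) b = p := by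
  have h : {m : Fin r →₀ ℕ | ((m.degree : ℕ) : ℤ) ≤ 0} = 0 := by
    ext m
    simpa using Finsupp.degree_eq_zero_iff m
  change p ∈ MvPolynomial.restrictSupport _ _ ↔ _
  rw [h, MvPolynomial.restrictSupport_zero, Submodule.mem_one]

/-- For `d + k = 0`, the filtration consists of the elements that are constant in `y`. -/
theorem mem_filtration_iff {d k : ℤ} (h : d + k = 0)
    (x : extPow A (Ω[A⁄K]) k ⊗[A] QuotPoly g) :
    x ∈ filtration K g d k ↔ ∃ y ∈ degPart A (Ω[A⁄K]) (Quot g) k,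
      constTensor A (Ω[A⁄K]) (Quot g) r y = incl A (Ω[A⁄K]) (QuotPoly g) k x := by
  let ι : Quot g →ₗ[A] QuotPoly g := (Algebra.linearMap (Quot g) (QuotPoly g)).restrictScalars A
  have hcomm : ∀ t, constTensor A (Ω[A⁄K]) (Quot g) r (incl A (Ω[A⁄K]) (Quot g) k t) =
      incl A (Ω[A⁄K]) (QuotPoly g) k (ι.lTensor _ t) := fun t => by
    induction t with
    | zero => simp
    | add t₁ t₂ h₁ h₂ => simp only [map_add, h₁, h₂]
    | tmul x b => rfl
  have hmem : ∀ b, ι b ∈ polyFiltration g (d + k) := fun b => by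
    rw [h]
    exact (mem_polyFiltration_zero_iff g _).2 ⟨b, rfl⟩
  have hrange : ∀ p ∈ polyFiltration g (d + k), ∃ b, ι b = p := fun p hp => by
    rw [h] at hp
    exact (mem_polyFiltration_zero_iff g p).1 hp
  constructor
  · rintro ⟨t, rfl⟩
    induction t with
    | zero => exact ⟨0, Submodule.zero_mem _, by simp⟩
    | add t₁ t₂ h₁ h₂ =>
      obtain ⟨y₁, hy₁, h₁⟩ := h₁
      obtain ⟨y₂, hy₂, h₂⟩ := h₂
      exact ⟨y₁ + y₂, Submodule.add_mem _ hy₁ hy₂, by simp only [map_add, h₁, h₂]⟩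
    | tmul x p =>
      obtain ⟨b, hb⟩ := hrange p p.2
      refine ⟨_, tmul_mem_degPart x.2 b, ?_⟩
      rw [LinearMap.lTensor_tmul, Submodule.subtype_apply, ← hb]
      rfl
  · rintro ⟨_, ⟨t, rfl⟩, ht⟩
    rw [hcomm] at ht
    rw [← incl_injective _ _ ht]
    let ι' : Quot g →ₗ[A] polyFiltration g (d + k) := ι.codRestrict _ hmem
    refine ⟨ι'.lTensor _ t, ?_⟩
    rw [← LinearMap.lTensor_comp_apply]
    rfl

/-- The degree `i` part of the complex `(Ω_{A/K} ⊗ B[y], dF ∧ ·)`, inside the algebra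
`⋀ Ω_{A/K} ⊗ B[y]`. -/
noncomputable def tensorIncl (i : ℤ) :
    (omegaTensor K f g).X i →ₗ[A] ExtTensor A (Ω[A⁄K]) (QuotPoly g) :=
  incl A (Ω[A⁄K]) (QuotPoly g) i

/-- The degree `i` part of the shifted complex `Ω_{B/K}[-r]`, inside the exterior algebra of
`Ω_{B/K}`. -/
noncomputable def shiftIncl (i : ℤ) :
    (shiftDown (omegaQuot K f g) r).X i →+ ExteriorAlgebra (Quot g) (Ω[Quot g⁄K]) :=
  (extPow (Quot g) (Ω[Quot g⁄K]) (i - r)).subtype.toAddMonoidHom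

theorem tensorIncl_injective (i : ℤ) : Function.Injective (tensorIncl K f g i) :=
  incl_injective _ i

theorem range_tensorIncl (i : ℤ) :
    LinearMap.range (tensorIncl K f g i) = degPart A (Ω[A⁄K]) (QuotPoly g) i := rfl

theorem tensorIncl_d {i j : ℤ} (h : i + 1 = j) (x : (omegaTensor K f g).X i) :
    tensorIncl K f g j (((omegaTensor K f g).d i j).hom x) =
      koszulDiff (Quot g) (fun j => KaehlerDifferential.D K A (g j))
        (KaehlerDifferential.D K A f) (tensorIncl K f g i x) := by
  have h1 : (omegaTensor K f g).d i j =
      ModuleCat.ofHom (wedgeTensor (QuotPoly g) h (dLagrange K f g)) := dif_pos h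
  rw [h1]
  exact incl_wedgeTensor h _ x

theorem shiftIncl_injective (i : ℤ) : Function.Injective (shiftIncl K f g i) :=
  Subtype.val_injective

theorem shiftIncl_mem (i : ℤ) (x : (shiftDown (omegaQuot K f g) r).X i) :
    shiftIncl K f g i x ∈ extPow (Quot g) (Ω[Quot g⁄K]) (i - r) :=
  Subtype.property (p := (· ∈ extPow (Quot g) (Ω[Quot g⁄K]) (i - r))) x

theorem exists_shiftIncl_eq (i : ℤ) {x : ExteriorAlgebra (Quot g) (Ω[Quot g⁄K])}
    (hx : x ∈ extPow (Quot g) (Ω[Quot g⁄K]) (i - r)) : ∃ y, shiftIncl K f g i y = x :=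
  ⟨(⟨x, hx⟩ : extPow (Quot g) (Ω[Quot g⁄K]) (i - r)), rfl⟩

theorem shiftIncl_smul (i : ℤ) (a : A) (x : (shiftDown (omegaQuot K f g) r).X i) :
    shiftIncl K f g i (a • x) = algebraMap A (Quot g) a • shiftIncl K f g i x := rfl

theorem shiftIncl_d {i j : ℤ} (h : i + 1 = j) (x : (shiftDown (omegaQuot K f g) r).X i) :
    shiftIncl K f g j (((shiftDown (omegaQuot K f g) r).d i j).hom x) =
      ExteriorAlgebra.ι (Quot g) (KaehlerDifferential.map K K A (Quot g)
        (KaehlerDifferential.D K A f)) * shiftIncl K f g i x := by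
  have h' : i - r + 1 = j - r := by rw [← h]; ring
  have h1 : (wedgeComplex (Quot g) (Ω[Quot g⁄K])
      (KaehlerDifferential.D K (Quot g) (algebraMap A (Quot g) f))).d (i - r) (j - r) =
      ModuleCat.ofHom (wedge h' (KaehlerDifferential.D K (Quot g) (algebraMap A (Quot g) f))) :=
    dif_pos h'
  have h2 : (shiftDown (omegaQuot K f g) r).d i j =
      (ModuleCat.restrictScalars (algebraMap A (Quot g))).map (ModuleCat.ofHom
        (wedge h' (KaehlerDifferential.D K (Quot g) (algebraMap A (Quot g) f)))) :=
    congrArg (fun d => (ModuleCat.restrictScalars (algebraMap A (Quot g))).map d) h1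
  rw [h2, KaehlerDifferential.map_D]
  rfl

theorem mem_L_iff (i : ℤ) (x : (omegaTensor K f g).X i) :
    x ∈ L K f g i ↔
      (∃ y ∈ degPart A (Ω[A⁄K]) (Quot g) i,
        constTensor A (Ω[A⁄K]) (Quot g) r y = tensorIncl K f g i x) ∧
      ∃ z ∈ degPart A (Ω[A⁄K]) (Quot g) (i + 1), constTensor A (Ω[A⁄K]) (Quot g) r z =
        tensorIncl K f g (i + 1) (((omegaTensor K f g).d i (i + 1)).hom x) :=
  and_congr (mem_filtration_iff K g (by ring) _) (mem_filtration_iff K g (by ring) _)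

variable (θ : Fin r → Module.Dual A (Ω[A⁄K])) (σ : Ω[Quot g⁄K] →ₗ[Quot g] Quot g ⊗[A] Ω[A⁄K])

/-- The map `ω ↦ σ(ω) ∧ dg₁ ∧ ⋯ ∧ dgᵣ`. -/
noncomputable def lagrangeMap :
    ExteriorAlgebra (Quot g) (Ω[Quot g⁄K]) →+ ExtTensor A (Ω[A⁄K]) (Quot g) :=
  (AddMonoidHom.mulRight
    (vecProd (Quot g) (fun j => KaehlerDifferential.D K A (g j)) (List.finRange r))).comp
      (extLift σ).toAddMonoidHom

theorem lagrangeMap_apply (x : ExteriorAlgebra (Quot g) (Ω[Quot g⁄K])) :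
    lagrangeMap K g σ x = extLift σ x *
      vecProd (Quot g) (fun j => KaehlerDifferential.D K A (g j)) (List.finRange r) := rfl

theorem lagrangeMap_smul (a : A) (x : ExteriorAlgebra (Quot g) (Ω[Quot g⁄K])) :
    lagrangeMap K g σ (algebraMap A (Quot g) a • x) = a • lagrangeMap K g σ x := by
  rw [lagrangeMap_apply, lagrangeMap_apply, extLift_smul,
    Algebra.algebraMap_eq_smul_one, TensorProduct.tmul_smul,
    ← Algebra.TensorProduct.one_def, smul_mul_assoc, one_mul, smul_mul_assoc]

variable {K g}

theorem lagrangeMap_mem {i k : ℤ} (h : i + r = k) {x : ExteriorAlgebra (Quot g) (Ω[Quot g⁄K])}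
    (hx : x ∈ extPow (Quot g) (Ω[Quot g⁄K]) i) :
    lagrangeMap K g σ x ∈ degPart A (Ω[A⁄K]) (Quot g) k :=
  mul_vecProd_mem _ _ (by simpa using h) (extLift_mem σ hx)

theorem vec_mul_lagrangeMap {i : ℤ} {x : ExteriorAlgebra (Quot g) (Ω[Quot g⁄K])}
    (hx : x ∈ extPow (Quot g) (Ω[Quot g⁄K]) i) (j : Fin r) :
    vec (Quot g) (KaehlerDifferential.D K A (g j)) * lagrangeMap K g σ x = 0 :=
  vec_mul_mul_vecProd_eq_zero (fun j => KaehlerDifferential.D K A (g j)) (List.mem_finRange j)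
    (extLift_mem σ hx)

/-- The morphism of complexes given by `ω ↦ σ(ω) ∧ dg₁ ∧ ⋯ ∧ dgᵣ`. -/
theorem exists_lagrangeHom
    (hσ : ∀ m : Ω[A⁄K], σ (KaehlerDifferential.map K K A (Quot g) m) =
        1 ⊗ₜ m - ∑ j, θ j m • (1 ⊗ₜ KaehlerDifferential.D K A (g j))) :
    ∃ φ : shiftDown (omegaQuot K f g) r ⟶ omegaTensor K f g,
      ∀ (i : ℤ) (ω : (shiftDown (omegaQuot K f g) r).X i),
        tensorIncl K f g i ((φ.f i).hom ω) =
          constTensor A (Ω[A⁄K]) (Quot g) r (lagrangeMap K g σ (shiftIncl K f g i ω)) := by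
  have hex : ∀ (i : ℤ) (ω : (shiftDown (omegaQuot K f g) r).X i), ∃ x, tensorIncl K f g i x =
      constTensor A (Ω[A⁄K]) (Quot g) r (lagrangeMap K g σ (shiftIncl K f g i ω)) := fun i ω =>
    constTensor_mem (lagrangeMap_mem σ (by ring) (shiftIncl_mem K f g i ω))
  choose F hF using hex
  have hadd : ∀ i ω ω', F i (ω + ω') = F i ω + F i ω' := fun i ω ω' => by
    apply tensorIncl_injective
    simp only [map_add, hF]
  have hsmul : ∀ i (a : A) ω, F i (a • ω) = a • F i ω := fun i a ω => by
    apply tensorIncl_injective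
    rw [map_smul, hF, hF, shiftIncl_smul, lagrangeMap_smul, map_smul]
  let Φ : ∀ i, (shiftDown (omegaQuot K f g) r).X i →ₗ[A] (omegaTensor K f g).X i := fun i =>
    { toFun := F i, map_add' := hadd i, map_smul' := hsmul i }
  refine ⟨{ f := fun i => ModuleCat.ofHom (X := (shiftDown (omegaQuot K f g) r).X i)
              (Y := (omegaTensor K f g).X i) (Φ i)
            comm' := ?_ }, fun i ω => hF i ω⟩
  intro i j hij
  have hij : i + 1 = j := hij
  ext ω
  apply tensorIncl_injective
  change tensorIncl K f g j (((omegaTensor K f g).d i j).hom (F i ω)) =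
    tensorIncl K f g j (F j (((shiftDown (omegaQuot K f g) r).d i j).hom ω))
  have hω := shiftIncl_mem K f g i ω
  rw [tensorIncl_d K f g hij, hF, hF, koszulDiff_constTensor _ _ (vec_mul_lagrangeMap σ hω),
    shiftIncl_d K f g hij]
  exact congrArg _ (extLift_ι_mul_mul_vecProd σ (fun j => KaehlerDifferential.D K A (g j)) θ
    (KaehlerDifferential.map K K A (Quot g)) hσ List.mem_finRange hω _).symm

end Assembly

end LagrangeKoszul

theorem theorem2p10 {K : Type*} {A : Type*} [Field K] [CommRing A] [Algebra K A]
    [Algebra.Smooth K A] (n : ℕ)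
    (hn : ∀ p ∈ minimalPrimes A, ringKrullDim (A ⧸ p) = (n : WithBot ℕ∞))
    (r : ℕ) (f : A) (g : Fin r → A)
    [Algebra.Smooth K (A ⧸ Ideal.span (Set.range g))]
    (hr : ∀ p ∈ (Ideal.span (Set.range g)).minimalPrimes, p.height = (r : ℕ∞)) :
    (∃ φ : LagrangeKoszul.shiftDown (LagrangeKoszul.omegaQuot K f g) r ⟶
        LagrangeKoszul.omegaTensor K f g,
      (∀ i : ℤ, Function.Injective (φ.f i).hom) ∧ QuasiIso φ ∧
        ∀ i : ℤ, LinearMap.range (φ.f i).hom = LagrangeKoszul.L K f g i) ∧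
    ∀ i : ℤ, Nonempty ((LagrangeKoszul.omegaQuot K f g).homology (i - r) ≅
      (LagrangeKoszul.omegaTensor K f g).homology i) := by
  open LagrangeKoszul in
  obtain ⟨θ, σ, hθ, hσ⟩ := exists_conormal_splitting K g fun p hp => (hr p hp).ge
  obtain ⟨φ, hφ⟩ := exists_lagrangeHom f θ σ hσ
  let e : Fin r → Ω[A⁄K] := fun j => KaehlerDifferential.D K A (g j)
  let w : Ω[A⁄K] := KaehlerDifferential.D K A f
  let ρ := KaehlerDifferential.map K K A (Quot g)
  have hρ : Function.Surjective ρ :=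
    KaehlerDifferential.map_surjective_of_surjective K K A (Quot g) Ideal.Quotient.mk_surjective
  have hρe : ∀ j, ρ (e j) = 0 := fun j => by
    have : algebraMap A (Quot g) (g j) = 0 :=
      Ideal.Quotient.eq_zero_iff_mem.2 (Ideal.subset_span ⟨j, rfl⟩)
    simp only [ρ, e, KaehlerDifferential.map_D, this, map_zero]
  have hcomm : ∀ i j ω, (φ.f j).hom (((shiftDown (omegaQuot K f g) r).d i j).hom ω) =
      ((omegaTensor K f g).d i j).hom ((φ.f i).hom ω) := fun i j ω =>
    (CategoryTheory.ConcreteCategory.congr_hom (φ.comm i j) ω).symm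
  have hdd : ∀ i j k x, ((omegaTensor K f g).d j k).hom (((omegaTensor K f g).d i j).hom x) = 0 :=
    fun i j k x => CategoryTheory.ConcreteCategory.congr_hom ((omegaTensor K f g).d_comp_d i j k) x
  have hinj : ∀ i : ℤ, Function.Injective (φ.f i).hom := fun i =>
    (injective_iff_map_eq_zero _).2 fun ω h0 => by
      have h1 := hφ i ω
      rw [h0, map_zero] at h1
      have h2 := constTensor_injective (h1.symm.trans (map_zero _).symm)
      apply shiftIncl_injective
      rw [map_zero]
      exact eq_zero_of_extLift_mul_vecProd_eq_zero σ e θ ρ hρ hσ hθ hρe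
        (List.nodup_finRange r) (shiftIncl_mem K f g i ω) h2
  -- constants killed by all `e j` come from forms on `B`
  have hlift : ∀ (i : ℤ) (x : (omegaTensor K f g).X i),
      ∀ y ∈ degPart A (Ω[A⁄K]) (Quot g) i, (∀ j, vec (Quot g) (e j) * y = 0) →
      constTensor A (Ω[A⁄K]) (Quot g) r y = tensorIncl K f g i x →
        ∃ ω, (φ.f i).hom ω = x := by
    intro i x y hy h0 hyx
    obtain ⟨ω, hω, rfl⟩ := exists_extLift_mul_vecProd_eq σ e θ ρ hσ hθ (List.nodup_finRange r)
      List.mem_finRange (i := i - r) (by simp) hy h0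
    obtain ⟨ω, rfl⟩ := exists_shiftIncl_eq K f g i hω
    exact ⟨ω, tensorIncl_injective K f g i ((hφ i ω).trans hyx)⟩
  have hnorm : ∀ (i : ℤ) (x : (omegaTensor K f g).X i),
      (∀ j, IsNormalized e θ w j (tensorIncl K f g i x)) → ∃ ω, (φ.f i).hom ω = x := by
    intro i x hx
    obtain ⟨y, hy, h0, hyx⟩ := exists_eq_constTensor e θ w ⟨x, rfl⟩ hx
    exact hlift i x y hy h0 hyx
  have hφn : ∀ (i : ℤ) ω j, IsNormalized e θ w j (tensorIncl K f g i ((φ.f i).hom ω)) :=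
    fun i ω j => by
      rw [hφ]
      exact isNormalized_constTensor e θ w
        (vec_mul_lagrangeMap σ (shiftIncl_mem K f g i ω)) j
  have hφc : ∀ (i : ℤ) ω, ∃ y ∈ degPart A (Ω[A⁄K]) (Quot g) i,
      constTensor A (Ω[A⁄K]) (Quot g) r y = tensorIncl K f g i ((φ.f i).hom ω) := fun i ω =>
    ⟨_, lagrangeMap_mem σ (by ring) (shiftIncl_mem K f g i ω), (hφ i ω).symm⟩
  have hrange : ∀ i : ℤ, LinearMap.range (φ.f i).hom = L K f g i := by
    intro i
    ext x
    rw [mem_L_iff]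
    constructor
    · rintro ⟨ω, rfl⟩
      refine ⟨hφc i ω, ?_⟩
      rw [← hcomm]
      exact hφc (i + 1) _
    · rintro ⟨⟨y, hy, hyx⟩, z, -, hz⟩
      rw [tensorIncl_d K f g rfl, ← hyx] at hz
      exact hlift i x y hy (vec_mul_eq_zero_of_koszulDiff_constTensor e w hz.symm) hyx
  have hqis : QuasiIso φ := by
    refine quasiIso_of_elementwise φ ?_ ?_
    · -- a cocycle `x` is cohomologous to a normalized one
      intro i j k hij hjk x hx
      have hdx : koszulDiff (Quot g) e w (tensorIncl K f g j x) = 0 := by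
        rw [← tensorIncl_d K f g hjk x, hx, map_zero]
      obtain ⟨_, hy, v, -, -, hv0, H⟩ := exists_normalized e θ w hθ Finset.univ hij
        (LinearMap.mem_range_self (tensorIncl K f g j) x) fun l => by
          rw [hdx]
          exact ⟨mul_zero _, map_zero _⟩
      rw [hv0 hdx] at H
      rw [← range_tensorIncl K f] at hy
      obtain ⟨y, rfl⟩ := hy
      obtain ⟨ω, hω⟩ := hnorm j (x - ((omegaTensor K f g).d i j).hom y) fun l => by
        have h1 := H l (Finset.mem_univ l)
        rw [map_sub, tensorIncl_d K f g hij]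
        rwa [sub_zero] at h1
      refine ⟨ω, hinj k ?_, y, sub_eq_iff_eq_add.1 hω.symm⟩
      rw [hcomm, hω, map_sub, hx, hdd, sub_zero, map_zero]
    · -- if `φ ω` is the boundary of `y`, then `y` can be chosen normalized
      intro i j k hij hjk ω y _ hωy
      have h1 : koszulDiff (Quot g) e w (tensorIncl K f g i y) =
          tensorIncl K f g j ((φ.f j).hom ω) := by
        rw [hωy, tensorIncl_d K f g hij]
      have hy := LinearMap.mem_range_self (tensorIncl K f g i) y
      obtain ⟨u, hu, v, hv, hdv, -, H⟩ := exists_normalized e θ w hθ Finset.univ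
        (sub_add_cancel i 1) hy fun l => by
          rw [h1]
          exact hφn j ω l
      obtain ⟨z, hz⟩ : ∃ z, tensorIncl K f g i z =
          tensorIncl K f g i y - koszulDiff (Quot g) e w u - v :=
        Submodule.sub_mem _ (Submodule.sub_mem _ hy
          (ιTensor_mul_mem (sub_add_cancel i 1) _ hu)) hv
      obtain ⟨η, rfl⟩ := hnorm i z fun l => by
        rw [hz]
        exact H l (Finset.mem_univ l)
      refine ⟨η, hinj j (tensorIncl_injective K f g j ?_)⟩
      rw [hcomm, tensorIncl_d K f g hij, hz, ← h1]
      have h2 := koszulDiff_koszulDiff e w hu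
      change _ = koszulDiff (Quot g) e w _
      rw [map_sub, map_sub, h2, hdv, sub_zero, sub_zero]
  refine ⟨⟨φ, hinj, hqis, hrange⟩, fun i => ?_⟩
  obtain ⟨ψ⟩ := nonempty_homology_shiftDown_iso (omegaQuot K f g) r i
  have := hqis.quasiIsoAt i
  exact ⟨ψ ≪≫ CategoryTheory.asIso (HomologicalComplex.homologyMap φ i)⟩
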